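/- Let $\mathbb K$ be a field of characteristic $0$ and let $n>10$. For $S\subset\mathbb Z/n$ with $0\notin S$, let $\vec C_n^{S}$ be the digraph with vertex set $\mathbb Z/n$ and arrows $a\to a+s$ ($a\in\mathbb Z/n$, $s\in S$). Let $R_m$ be the span of all vertex sequences $e_{v_0\dots v_m}$ modulo those with $v_{k-1}=v_k$ for some $k$, with $\partial e_{v_0\dots v_m}=\sum_j(-1)^je_{v_0\dots\widehat{v_j}\dots v_m}$. Let $A_m\subset R_m$ be the span of the directed paths of $\vec C_n^S$, let $\Omega_0=A_0$, $\Omega_m=\{u\in A_m:\partial u\in A_{m-1}\}$ for $m\ge1$ (for $m=1$ this is $A_1$), and let $H_m^{\mathrm{path}}(\vec C_n^S;\mathbb K)=H_m(\Omega_*,\partial)$. Let $\tau$ be the map on paths induced by $a\mapsto a+1$, and for $\lambda\in\mathbb K$ with $\lambda^n=1$ let $\Omega_m^{(\lambda)}=\{\alpha\in\Omega_m:\tau\alpha=\lambda\alpha\}$. For a word $w=(s_1,\dots,s_m)$ put $$f_w=\sum_{a=0}^{n-1}\lambda^{-a}\,e_{a,\,a+s_1,\,\dots,\,a+s_1+\cdots+s_m},$$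 and for a multiset $c$ of $m$ letters put $F_m(c)=\sum_w(-1)^{\mathrm{inv}(w)}f_w$, summed over the distinct words $w$ with letters $c$, where $\mathrm{inv}(w)$ is the number of pairs $i<j$ with $s_i>s_j$. Write $1^a2^b4^c$ etc. for multisets. (1) The Betti numbers $\dim_{\mathbb K} H_m^{\mathrm{path}}(\vec C_n^{1,2,4};\mathbb K)$, $m=0,1,2,\dots$, are $1,1,0,0,\dots$. For every $m\ge0$ and every $\lambda\in\mathbb K$ with $\lambda^n=1$, the elements $U_{m,k}=F_m(1^{m-k}2^k)$ ($0\le k\le m$) and $V_{m,k}=F_m(1^{m-1-k}2^k4)$ ($0\le k\le m-1$) form a basis of $\Omega_m^{(\lambda)}$; hence $\dim\Omega_m^{(\lambda)}=2m+1$. For $m\ge1$ there is a symbol matrix $M_m(t)$ with entries in $\mathbb Z[t]$, depending only on $m$ (not on $n$, $\lambda$ or $\mathbb K$), such that $M_m(\lambda)$ is the matrix of $\partial_m:\Omega_m^{(\lambda)}\to\Omega_{m-1}^{(\lambda)}$ in these bases; its rank is $\operatorname{rank}M_m(\lambda)=m$ whenever $m\ge2$, and also for $m=1$ if $\lambda\ne1$.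 (2) The Betti numbers $\dim_{\mathbb K} H_m^{\mathrm{path}}(\vec C_n^{1,2,5};\mathbb K)$, $m=0,1,2,\dots$, are $1,2,1,0,0,\dots$. For every $m\ge2$ and every $\lambda\in\mathbb K$ with $\lambda^n=1$, the elements $A_m=F_m(1^m)$, $B_m=F_m(1^{m-1}2)$, $C_m=F_m(1^{m-1}5)$, $D_m=F_m(1^{m-2}2\,5)$ form a basis of $\Omega_m^{(\lambda)}$; hence $\dim\Omega_m^{(\lambda)}=4$. For $m\ge3$ there is a symbol matrix $M_m(t)$ with entries in $\mathbb Z[t]$, depending only on $m$, such that $M_m(\lambda)$ is the matrix of $\partial_m:\Omega_m^{(\lambda)}\to\Omega_{m-1}^{(\lambda)}$ in these bases, and $\operatorname{rank}M_m(\lambda)=2$. -/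

import Mathlib

open Polynomial

namespace PathComplex

section General

/-- The space `Λ_m(V; K)` spanned by all elementary `m`-paths `(v_0, …, v_m)` in `V`. -/
abbrev Chains (K V : Type*) [Field K] (m : ℕ) : Type _ := (Fin (m + 1) → V) →₀ K

/-- The elementary path `e_v`. -/
noncomputable abbrev elem (K : Type*) {V : Type*} [Field K] {m : ℕ} (v : Fin (m + 1) → V) :
    Chains K V m := Finsupp.single v 1

/-- `∂ : Λ_{m+1} → Λ_m`, `∂ e_v = ∑_j (-1)^j e_{v with v_j omitted}`. -/
noncomputable def chainBoundary (K V : Type*) [Field K] (m : ℕ) :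
    Chains K V (m + 1) →ₗ[K] Chains K V m :=
  Finsupp.linearCombination K fun v : Fin (m + 2) → V =>
    ∑ j : Fin (m + 2), (-1 : K) ^ (j : ℕ) • elem K (v ∘ j.succAbove)

/-- An elementary path is irregular if two consecutive vertices coincide. -/
def IsIrregular {V : Type*} {m : ℕ} (v : Fin (m + 1) → V) : Prop :=
  ∃ i : Fin m, v i.castSucc = v i.succ

/-- The span `I_m(V; K)` of the irregular elementary paths. -/
noncomputable def irregular (K V : Type*) [Field K] (m : ℕ) : Submodule K (Chains K V m) :=
  Submodule.span K {x | ∃ v : Fin (m + 1) → V, IsIrregular v ∧ x = elem K v}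

/-- The space of regular paths `R_m(V; K) = Λ_m / I_m`. -/
abbrev Reg (K V : Type*) [Field K] (m : ℕ) : Type _ := Chains K V m ⧸ irregular K V m

theorem chainBoundary_elem (K : Type*) {V : Type*} [Field K] {m : ℕ} (v : Fin (m + 2) → V) :
    chainBoundary K V m (elem K v) =
      ∑ j : Fin (m + 2), (-1 : K) ^ (j : ℕ) • elem K (v ∘ j.succAbove) := by
  simp [chainBoundary]

theorem chainBoundary_comp (K V : Type*) [Field K] (m : ℕ) :
    chainBoundary K V m ∘ₗ chainBoundary K V (m + 1) = 0 := by
  refine Finsupp.lhom_ext' fun v => LinearMap.ext_ring ?_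
  change chainBoundary K V m (chainBoundary K V (m + 1) (elem K v)) = 0
  rw [chainBoundary_elem]
  simp only [map_sum, map_smul, chainBoundary_elem, Finset.smul_sum, smul_smul]
  rw [← Finset.sum_product' (f := fun (i : Fin (m + 3)) (j : Fin (m + 2)) =>
    ((-1 : K) ^ (i : ℕ) * (-1 : K) ^ (j : ℕ)) • elem K ((v ∘ i.succAbove) ∘ j.succAbove))]
  have key : ∀ (i : Fin (m + 3)) (j : Fin (m + 2)),
      ((-1 : K) ^ ((i.succAbove j : Fin (m + 3)) : ℕ) *
        (-1 : K) ^ ((j.predAbove i : Fin (m + 2)) : ℕ)) =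
      -((-1 : K) ^ (i : ℕ) * (-1 : K) ^ (j : ℕ)) := by
    intro i j
    rw [← pow_add, ← pow_add, Fin.neg_one_pow_succAbove_add_predAbove]
  refine Finset.sum_involution (fun p _ => (p.1.succAbove p.2, p.2.predAbove p.1)) ?_ ?_ ?_ ?_
  · rintro ⟨i, j⟩ -
    have h : ((v ∘ (i.succAbove j).succAbove) ∘ (j.predAbove i).succAbove) =
        ((v ∘ i.succAbove) ∘ j.succAbove) := by
      funext k
      simp [Fin.succAbove_succAbove_succAbove_predAbove]
    simp only [h, key, neg_smul, add_neg_cancel]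
  · rintro ⟨i, j⟩ - - h
    exact Fin.succAbove_ne i j (congrArg Prod.fst h)
  · intro p _
    simp
  · rintro ⟨i, j⟩ -
    simp [Fin.succAbove_succAbove_predAbove, Fin.predAbove_predAbove_succAbove]

theorem chainBoundary_irregular (K V : Type*) [Field K] (m : ℕ) :
    irregular K V (m + 1) ≤ (irregular K V m).comap (chainBoundary K V m) := by
  refine Submodule.span_le.2 ?_
  rintro x ⟨v, ⟨i, hi⟩, rfl⟩
  change chainBoundary K V m (elem K v) ∈ irregular K V m
  have hne : i.castSucc ≠ i.succ := by simp [Fin.ext_iff]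
  rw [chainBoundary_elem, ← Finset.add_sum_erase _ _ (Finset.mem_univ i.castSucc),
    ← Finset.add_sum_erase _ _ (Finset.mem_erase.2 ⟨hne.symm, Finset.mem_univ i.succ⟩), ← add_assoc]
  have hv : v ∘ i.castSucc.succAbove = v ∘ i.succ.succAbove := by
    funext k
    rcases lt_trichotomy k i with h | h | h
    · simp [Fin.succAbove, Fin.lt_def, Fin.lt_def.1 h, (Fin.lt_def.1 h).trans (Nat.lt_succ_self _)]
    · subst h
      simp [hi]
    · have h' := Fin.lt_def.1 h
      simp [Fin.succAbove, Fin.lt_def, not_lt.2 h'.le, not_lt.2 (Nat.succ_le_of_lt h')]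
  refine Submodule.add_mem _ ?_ (Submodule.sum_mem _ ?_)
  · rw [hv, ← add_smul]
    simp [pow_succ]
  · intro j hj
    simp only [Finset.mem_erase, Finset.mem_univ, and_true] at hj
    refine Submodule.smul_mem _ _ (Submodule.subset_span ⟨_, ?_, rfl⟩)
    obtain ⟨h1, h2⟩ := hj
    have h1' : (j : ℕ) ≠ i + 1 := fun h => h1 (Fin.ext (by simpa using h))
    have h2' : (j : ℕ) ≠ i := fun h => h2 (Fin.ext (by simpa using h))
    have hjl := j.2
    have hil := i.2
    rcases lt_or_gt_of_ne h2' with h | h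
    · refine ⟨⟨i - 1, by omega⟩, ?_⟩
      have e1 : j.succAbove (Fin.castSucc ⟨(i : ℕ) - 1, by omega⟩ : Fin (m + 1)) = i.castSucc := by
        rw [Fin.succAbove_of_le_castSucc _ _ (by simp [Fin.le_def]; omega)]
        ext; simp; omega
      have e2 : j.succAbove (Fin.succ ⟨(i : ℕ) - 1, by omega⟩ : Fin (m + 1)) = i.succ := by
        rw [Fin.succAbove_of_le_castSucc _ _ (by simp [Fin.le_def]; omega)]
        ext; simp; omega
      simp only [Function.comp_apply, e1, e2, hi]
    · refine ⟨⟨i, by omega⟩, ?_⟩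
      have e1 : j.succAbove (Fin.castSucc ⟨(i : ℕ), by omega⟩ : Fin (m + 1)) = i.castSucc := by
        rw [Fin.succAbove_of_castSucc_lt _ _ (by simp [Fin.lt_def]; omega)]
        ext; simp
      have e2 : j.succAbove (Fin.succ ⟨(i : ℕ), by omega⟩ : Fin (m + 1)) = i.succ := by
        rw [Fin.succAbove_of_castSucc_lt _ _ (by simp [Fin.lt_def]; omega)]
        ext; simp
      simp only [Function.comp_apply, e1, e2, hi]

/-- The induced boundary operator `∂ : R_{m+1} → R_m`. -/
noncomputable def boundary (K V : Type*) [Field K] (m : ℕ) :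
    Reg K V (m + 1) →ₗ[K] Reg K V m :=
  (irregular K V (m + 1)).mapQ (irregular K V m) (chainBoundary K V m)
    (chainBoundary_irregular K V m)

theorem boundary_boundary (K V : Type*) [Field K] (m : ℕ) (x : Reg K V (m + 2)) :
    boundary K V m (boundary K V (m + 1) x) = 0 := by
  induction x using Submodule.Quotient.induction_on with
  | H x =>
    have h := LinearMap.congr_fun (chainBoundary_comp K V m) x
    simp only [LinearMap.comp_apply, LinearMap.zero_apply] at h
    simp [boundary, h]

/-- The space `A_m(G; K)` of allowed `m`-paths of the digraph `G`. -/
noncomputable def allowed (K : Type*) {V : Type*} [Field K] (G : Digraph V) (m : ℕ) :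
    Submodule K (Reg K V m) :=
  Submodule.span K {x | ∃ v : Fin (m + 1) → V, (∀ i : Fin m, G.Adj (v i.castSucc) (v i.succ)) ∧
    x = (irregular K V m).mkQ (elem K v)}

/-- The space `Ω_m(G; K)` of `∂`-invariant paths: `Ω_0 = A_0` and
`Ω_{m+1} = {u ∈ A_{m+1} : ∂ u ∈ A_m}` (for `m = 0` the second condition is void). -/
noncomputable def Omega (K : Type*) {V : Type*} [Field K] (G : Digraph V) : (m : ℕ) → Submodule K (Reg K V m)
  | 0 => allowed K G 0
  | m + 1 => allowed K G (m + 1) ⊓ (allowed K G m).comap (boundary K V m)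

theorem boundary_mem_Omega (K : Type*) {V : Type*} [Field K] (G : Digraph V) (m : ℕ) :
    ∀ x ∈ Omega K G (m + 1), boundary K V m x ∈ Omega K G m := by
  intro x hx
  cases m with
  | zero => exact hx.2
  | succ m =>
    refine ⟨hx.2, ?_⟩
    simp [boundary_boundary]

noncomputable instance (K : Type*) {V : Type*} [Field K] (G : Digraph V) (m : ℕ) :
    AddCommGroup (Omega K G m) :=
  Submodule.addCommGroup _

/-- The differential `∂_{m+1} : Ω_{m+1}(G) → Ω_m(G)` of the path complex. -/
noncomputable def dOmega (K : Type*) {V : Type*} [Field K] (G : Digraph V) (m : ℕ) :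
    Omega K G (m + 1) →ₗ[K] Omega K G m :=
  (boundary K V m).restrict (boundary_mem_Omega K G m)

/-- The cycles of the path complex in degree `m`; the differential leaving degree `0` is zero. -/
noncomputable def cycles (K : Type*) {V : Type*} [Field K] (G : Digraph V) :
    (m : ℕ) → Submodule K (Omega K G m)
  | 0 => ⊤
  | m + 1 => LinearMap.ker (dOmega K G m)

/-- The path homology `H_m(G; K)`: cycles modulo boundaries. -/
abbrev Homology (K : Type*) {V : Type*} [Field K] (G : Digraph V) (m : ℕ) :=
  cycles K G m ⧸ (LinearMap.range (dOmega K G m)).submoduleOf (cycles K G m)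

end General

section Circulant

/-- The circulant digraph with vertex set `ℤ/n` and arrows `a → a + s`, `s ∈ S`. -/
def circulant (n : ℕ) (S : Set (ZMod n)) : Digraph (ZMod n) where
  Adj a b := ∃ s ∈ S, b = a + s

/-- The shift `a ↦ a + 1` applied to all vertices of a path, on `Λ_m`. -/
noncomputable def chainShift (K : Type*) [Field K] (n m : ℕ) :
    Chains K (ZMod n) m →ₗ[K] Chains K (ZMod n) m :=
  Finsupp.lmapDomain K K fun v i => v i + 1

theorem chainShift_irregular (K : Type*) [Field K] (n m : ℕ) :
    irregular K (ZMod n) m ≤ (irregular K (ZMod n) m).comap (chainShift K n m) := by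
  refine Submodule.span_le.2 ?_
  rintro x ⟨v, ⟨i, hi⟩, rfl⟩
  refine Submodule.subset_span ⟨fun i => v i + 1, ⟨i, by simp [hi]⟩, ?_⟩
  simp [chainShift]

/-- The shift `τ` on regular paths. -/
noncomputable def shift (K : Type*) [Field K] (n m : ℕ) :
    Module.End K (Reg K (ZMod n) m) :=
  (irregular K (ZMod n) m).mapQ (irregular K (ZMod n) m) (chainShift K n m)
    (chainShift_irregular K n m)

theorem boundary_shift (K : Type*) [Field K] (n m : ℕ) (x : Reg K (ZMod n) (m + 1)) :
    boundary K (ZMod n) m (shift K n (m + 1) x) = shift K n m (boundary K (ZMod n) m x) := by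
  have h : chainBoundary K (ZMod n) m ∘ₗ chainShift K n (m + 1) =
      chainShift K n m ∘ₗ chainBoundary K (ZMod n) m := by
    refine Finsupp.lhom_ext' fun v => LinearMap.ext_ring ?_
    change chainBoundary K (ZMod n) m (chainShift K n (m + 1) (elem K v)) =
      chainShift K n m (chainBoundary K (ZMod n) m (elem K v))
    have hs : ∀ (k : ℕ) (u : Fin (k + 1) → ZMod n),
        chainShift K n k (elem K u) = elem K fun i => u i + 1 := by
      intro k u
      simp [chainShift]
    rw [hs, chainBoundary_elem, chainBoundary_elem, map_sum]
    simp only [map_smul, hs]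
    rfl
  induction x using Submodule.Quotient.induction_on with
  | H x =>
    have hx := LinearMap.congr_fun h x
    simp only [LinearMap.comp_apply] at hx
    simp [boundary, shift, hx]

/-- `Ω_m^{(lam)} = {α ∈ Ω_m : τ α = lam α}` for the circulant digraph on `ℤ/n` with steps `S`. -/
noncomputable def OmegaEig (K : Type*) [Field K] (n : ℕ) (S : Set (ZMod n)) (lam : K) (m : ℕ) :
    Submodule K (Reg K (ZMod n) m) :=
  Omega K (circulant n S) m ⊓ Module.End.eigenspace (shift K n m) lam

theorem boundary_mem_OmegaEig (K : Type*) [Field K] (n : ℕ) (S : Set (ZMod n)) (lam : K) (m : ℕ) :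
    ∀ x ∈ OmegaEig K n S lam (m + 1), boundary K (ZMod n) m x ∈ OmegaEig K n S lam m := by
  intro x hx
  refine ⟨boundary_mem_Omega K _ m x hx.1, ?_⟩
  have h := Module.End.mem_eigenspace_iff.1 hx.2
  exact Module.End.mem_eigenspace_iff.2 (by rw [← boundary_shift, h, map_smul])

/-- The differential `∂_{m+1} : Ω_{m+1}^{(lam)} → Ω_m^{(lam)}`. -/
noncomputable def dEig (K : Type*) [Field K] (n : ℕ) (S : Set (ZMod n)) (lam : K) (m : ℕ) :
    OmegaEig K n S lam (m + 1) →ₗ[K] OmegaEig K n S lam m :=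
  (boundary K (ZMod n) m).restrict (boundary_mem_OmegaEig K n S lam m)

/-- The elementary path `(a; w_1, …, w_m)` with vertices `a, a + w_1, a + w_1 + w_2, …`. -/
noncomputable def stepPath (K : Type*) [Field K] (n : ℕ) {m : ℕ} (a : ZMod n) (w : Fin m → ℕ) :
    Reg K (ZMod n) m :=
  (irregular K (ZMod n) m).mkQ
    (elem K fun i => a + Fin.partialSum (fun j => (w j : ZMod n)) i)

/-- The Fourier generator `f_w = ∑_{a ∈ ℤ/n} lam^{-a} (a; w)` (used for `lam ^ n = 1`). -/
noncomputable def fourierGen (K : Type*) [Field K] (n : ℕ) (lam : K) {m : ℕ} (w : Fin m → ℕ) :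
    Reg K (ZMod n) m :=
  ∑ a ∈ Finset.range n, (lam⁻¹) ^ a • stepPath K n (a : ZMod n) w

/-- The words of length `m` whose letters, with multiplicity, are those of `c`. -/
def shuffles (m : ℕ) (c : Multiset ℕ) : Finset (Fin m → ℕ) :=
  {w ∈ Fintype.piFinset fun _ : Fin m => c.toFinset | Finset.univ.val.map w = c}

/-- The number of inversions of a word. -/
def inversions {m : ℕ} (w : Fin m → ℕ) : ℕ :=
  Finset.card {p : Fin m × Fin m | p.1 < p.2 ∧ w p.2 < w p.1}

/-- The alternating shuffle sum `∑_{w ∈ Sh(c)} (-1)^{inv w} f_w`. -/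
noncomputable def alternator (K : Type*) [Field K] (n : ℕ) (lam : K) (m : ℕ) (c : Multiset ℕ) :
    Reg K (ZMod n) m :=
  ∑ w ∈ shuffles m c, (-1 : K) ^ inversions w • fourierGen K n lam w

/-- The letters of the generators for steps `{1, 2, 4}` in degree `m`:
`U_{m,k}` has letters `1^{m-k} 2^k` for `0 ≤ k ≤ m`, and
`V_{m,k}` has letters `1^{m-1-k} 2^k 4` for `0 ≤ k ≤ m - 1`. -/
def letters124 (m : ℕ) : Fin (m + 1) ⊕ Fin m → Multiset ℕ
  | .inl k => Multiset.replicate (m - k) 1 + Multiset.replicate k 2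
  | .inr k => Multiset.replicate (m - 1 - k) 1 + Multiset.replicate k 2 + {4}

/-- The letters of the generators `A_m, B_m, C_m, D_m` for steps `{1, 2, 5}` in degree `m ≥ 2`:
`1^m`, `1^{m-1} 2`, `1^{m-1} 5` and `1^{m-2} 2 5`. -/
def letters125 (m : ℕ) : Fin 4 → Multiset ℕ :=
  ![Multiset.replicate m 1, Multiset.replicate (m - 1) 1 + {2},
    Multiset.replicate (m - 1) 1 + {5}, Multiset.replicate (m - 2) 1 + {2, 5}]

end Circulant

end PathComplex

/-! Encode a path by its first vertex and its word of steps. A sum of two letters is at most 10 <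
`n`, so it never wraps around `ℤ/n`. For an allowed chain `u`, the coefficient of `∂u` at a path
with a step `r` that is not a letter sees only the splittings `r = s + t` into letters. Distinct
unordered pairs from {1, 2, 4}, and likewise from {1, 2, 5}, have distinct sums. Hence `u` lies in
`Ω` exactly when its coefficients change sign under every swap of neighbouring letters whose sum is
not a letter (`mem_Omega_iff`).

Two distinct letters never sum to a letter, so sorting reduces every coefficient to one at a word
`1^p 2^q z^r`. In characteristic 0 a letter whose double is not a letter cannot repeat: 1 may
repeat, 2 may repeat only if `z = 4`, and `z` never. The remaining coefficients are arbitrary, and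
the alternating shuffle sums are dual to them. So `Ω_m` is a sum of copies of the functions on
`ℤ/n`, one per admissible multiset (`omegaEquiv`), and an eigenspace has one copy of `K` per
multiset (`eigEquiv`).

In these coordinates (`coord_boundary`) the boundary adds a letter at either end, or splits 2 = 1 +
1 and, for `z = 4`, 4 = 2 + 2. The splittings inside a block of equal letters alternate in sign, so
they survive only for odd multiplicity, and then with coefficient ±1. These units allow the cycle
equations to be solved recursively: a cycle is determined by few coordinates, which bounds the ranks
from below. Since `∂∂ = 0`, two consecutive ranks sum to at most the dimension between them. The
lower bounds already reach that dimension, so in high degrees they are equalities and the complex is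
exact.

The argument runs separately on `Ω` and on each eigenspace, because `K` need not contain the `n`-th
roots of unity. What is left is low degree: `∂_1` has rank `n - 1`, and for {1, 2, 5} the rank of
`∂_2` drops to `2n - 1` because of a 2-cycle that does not bound. -/

open Polynomial

namespace PathComplex

/-! ### Coefficient functionals on regular paths -/

section Coefficients

variable {K V : Type*} [Field K] {m : ℕ}

theorem mem_irregular_iff {x : Chains K V m} :
    x ∈ irregular K V m ↔ ∀ v, ¬ IsIrregular v → x v = 0 := by
  have h : irregular K V m = Finsupp.supported K K {v | IsIrregular v} := by
    rw [Finsupp.supported_eq_span_single, irregular]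
    congr 1
    ext x
    simp [elem, eq_comm]
  rw [h, Finsupp.mem_supported']
  rfl

/-- The coefficient of the regular elementary path `e_v` (zero if `v` is irregular). -/
noncomputable def coef (v : Fin (m + 1) → V) : Reg K V m →ₗ[K] K :=
  open Classical in
  if h : IsIrregular v then 0 else
    (irregular K V m).liftQ (Finsupp.lapply v) fun _ hx =>
      LinearMap.mem_ker.2 (mem_irregular_iff.1 hx v h)

theorem coef_of_irregular {v : Fin (m + 1) → V} (h : IsIrregular v) (x : Reg K V m) :
    coef v x = 0 := by
  simp [coef, h]

theorem coef_mkQ {v : Fin (m + 1) → V} (h : ¬ IsIrregular v) (y : Chains K V m) :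
    coef v ((irregular K V m).mkQ y) = y v := by
  rw [coef, dif_neg h, Submodule.mkQ_apply, Submodule.liftQ_apply]
  rfl

theorem coef_elem (v w : Fin (m + 1) → V) [Decidable (¬ IsIrregular v ∧ w = v)] :
    coef v ((irregular K V m).mkQ (elem K w)) = if ¬ IsIrregular v ∧ w = v then 1 else 0 := by
  classical
  by_cases h : IsIrregular v
  · simp [coef_of_irregular h, h]
  · rw [coef_mkQ h]
    simp [h, Finsupp.single_apply]

theorem reg_ext {x y : Reg K V m} (h : ∀ v, coef v x = coef v y) : x = y := by
  induction x using Submodule.Quotient.induction_on with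
  | H x =>
    induction y using Submodule.Quotient.induction_on with
    | H y =>
      refine (Submodule.Quotient.eq _).2 (mem_irregular_iff.2 fun v hv => ?_)
      have := h v
      erw [coef_mkQ hv, coef_mkQ hv] at this
      simp [this]

theorem reg_hom_ext {M : Type*} [AddCommGroup M] [Module K M] {f g : Reg K V m →ₗ[K] M}
    (h : ∀ w, f ((irregular K V m).mkQ (elem K w)) = g ((irregular K V m).mkQ (elem K w))) :
    f = g := by
  refine Submodule.linearMap_qext _ (Finsupp.lhom_ext' fun v => LinearMap.ext_ring ?_)
  exact h v

theorem mkQ_elem_of_irregular {v : Fin (m + 1) → V} (h : IsIrregular v) :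
    (irregular K V m).mkQ (elem K v) = 0 := by
  rw [Submodule.mkQ_apply, Submodule.Quotient.mk_eq_zero]
  exact Submodule.subset_span ⟨v, h, rfl⟩

theorem boundary_elem (v : Fin (m + 2) → V) :
    boundary K V m ((irregular K V (m + 1)).mkQ (elem K v)) =
      ∑ j : Fin (m + 2), (-1 : K) ^ (j : ℕ) • (irregular K V m).mkQ (elem K (v ∘ j.succAbove)) := by
  simp only [boundary, Submodule.mkQ_apply, Submodule.mapQ_apply, chainBoundary_elem]
  rw [← Submodule.mkQ_apply, map_sum]
  exact Finset.sum_congr rfl fun j _ => map_smul _ _ _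

/-- Transpose of the formula for `∂`: a path has `v` as its `j`-th face exactly when it is `v` with
a vertex inserted at position `j`. Regularity of `v` matters: inserting a vertex between equal
neighbours can give a regular path. -/
theorem coef_boundary [Fintype V] {v : Fin (m + 1) → V} (hv : ¬ IsIrregular v)
    (x : Reg K V (m + 1)) :
    coef v (boundary K V m x) = ∑ j : Fin (m + 2), (-1 : K) ^ (j : ℕ) *
      ∑ y : V, coef (Fin.insertNth (α := fun _ => V) j y v) x := by
  classical
  have key : coef v ∘ₗ boundary K V m = ∑ j : Fin (m + 2), (-1 : K) ^ (j : ℕ) •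
      ∑ y : V, coef (Fin.insertNth (α := fun _ => V) j y v) := by
    refine reg_hom_ext fun w => ?_
    simp only [LinearMap.comp_apply, LinearMap.sum_apply, LinearMap.smul_apply]
    by_cases hw : IsIrregular w
    · simp [mkQ_elem_of_irregular hw]
    · rw [boundary_elem, map_sum]
      refine Finset.sum_congr rfl fun j _ => ?_
      rw [map_smul, coef_elem]
      congr 1
      simp only [coef_elem, Fin.eq_insertNth_iff]
      have e : ∀ y : V, (¬ IsIrregular (Fin.insertNth (α := fun _ => V) j y v) ∧
          w j = y ∧ j.removeNth w = v) ↔ (w j = y ∧ j.removeNth w = v) := by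
        refine fun y => ⟨fun h => h.2, fun h => ⟨?_, h⟩⟩
        rwa [← Fin.eq_insertNth_iff.2 h]
      simp only [e, ite_and, Finset.sum_ite_eq, Finset.mem_univ, if_true]
      simp only [hv, not_false_eq_true, if_true]
      rfl
  simpa using LinearMap.congr_fun key x

/-- All steps of `v` are arrows of `G`. -/
def IsAllowed (G : Digraph V) (v : Fin (m + 1) → V) : Prop :=
  ∀ i : Fin m, G.Adj (v i.castSucc) (v i.succ)

theorem mem_allowed_iff {G : Digraph V} {x : Reg K V m} :
    x ∈ allowed K G m ↔ ∀ v, ¬ IsAllowed G v → coef v x = 0 := by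
  classical
  constructor
  · intro hx v hv
    refine Submodule.span_induction (p := fun x _ => coef v x = 0) ?_ ?_ ?_ ?_ hx
    · rintro x ⟨w, hw, rfl⟩
      rw [coef_elem, if_neg]
      rintro ⟨-, rfl⟩
      exact hv hw
    · simp
    · intro x y _ _ hx hy
      simp [hx, hy]
    · intro a x _ hx
      simp [hx]
  · intro h
    induction x using Submodule.Quotient.induction_on with
    | H x =>
      rw [← Submodule.mkQ_apply] at h ⊢
      rw [← Finsupp.sum_single x, Finsupp.sum, map_sum]
      refine Submodule.sum_mem _ fun v _ => ?_
      rw [← mul_one (x v), ← smul_eq_mul, ← Finsupp.smul_single, map_smul]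
      by_cases hi : IsIrregular v
      · rw [mkQ_elem_of_irregular hi]
        simp
      by_cases hv : IsAllowed G v
      · exact Submodule.smul_mem _ _ (Submodule.subset_span ⟨v, hv, rfl⟩)
      · have := h v hv
        rw [coef_mkQ hi] at this
        simp [this]

theorem Omega_le_allowed (G : Digraph V) (m : ℕ) : Omega K G m ≤ allowed K G m := by
  cases m with
  | zero => exact le_rfl
  | succ m => exact inf_le_left

/-- Deleting a vertex affects only the arrows at that vertex. This singles out the one insertion
that can repair a forbidden step. -/
theorem IsAllowed.adj_of_ne {G : Digraph V} {w : Fin (m + 2) → V} (hw : IsAllowed G w)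
    {j : Fin (m + 2)} {i : Fin m} (hij : (j : ℕ) ≠ i + 1) :
    G.Adj (w (j.succAbove i.castSucc)) (w (j.succAbove i.succ)) := by
  rcases lt_or_gt_of_ne hij with h | h
  · have e1 : j.succAbove i.castSucc = i.succ.castSucc := by
      rw [Fin.succAbove_of_le_castSucc _ _ (by simp [Fin.le_def]; omega)]
      ext; simp
    have e2 : j.succAbove i.succ = i.succ.succ := by
      rw [Fin.succAbove_of_le_castSucc _ _ (by simp [Fin.le_def]; omega)]
    rw [e1, e2]
    exact hw i.succ
  · have e1 : j.succAbove i.castSucc = i.castSucc.castSucc := by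
      rw [Fin.succAbove_of_castSucc_lt _ _ (by simp [Fin.lt_def]; omega)]
    have e2 : j.succAbove i.succ = i.castSucc.succ := by
      rw [Fin.succAbove_of_castSucc_lt _ _ (by simp [Fin.lt_def]; omega)]
      ext; simp
    rw [e1, e2]
    exact hw i.castSucc

end Coefficients

/-! ### Paths as a starting vertex and a list of steps -/

section Walks

variable {n : ℕ}

/-- The vertex sequence with start `a` and steps `l`. -/
def walk (n m : ℕ) (a : ZMod n) (l : List ℕ) : Fin (m + 1) → ZMod n :=
  fun i => a + ((l.take i).sum : ℕ)

theorem walk_succ {m : ℕ} (a : ZMod n) {l : List ℕ} (i : Fin m) (h : (i : ℕ) < l.length) :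
    walk n m a l i.succ = walk n m a l i.castSucc + (l[(i : ℕ)] : ℕ) := by
  simp [walk, List.sum_take_succ _ _ h, add_assoc]

theorem walk_zero {m : ℕ} (a : ZMod n) (l : List ℕ) : walk n m a l 0 = a := by
  simp [walk]

theorem exists_eq_walk [NeZero n] {m : ℕ} (v : Fin (m + 1) → ZMod n) :
    ∃ l : List ℕ, l.length = m ∧ (∀ s ∈ l, s < n) ∧ v = walk n m (v 0) l := by
  refine ⟨List.ofFn fun i : Fin m => (v i.succ - v i.castSucc).val, by simp, ?_, ?_⟩
  · intro s hs
    obtain ⟨i, rfl⟩ := (List.mem_ofFn' _ _).1 hs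
    exact ZMod.val_lt _
  · funext i
    induction i using Fin.induction with
    | zero => simp [walk_zero]
    | succ i ih =>
      rw [walk_succ _ _ (by simp), ← ih]
      simp

theorem walk_injective {m : ℕ} {a b : ZMod n} {l k : List ℕ} (hl : l.length = m)
    (hk : k.length = m) (hln : ∀ s ∈ l, s < n) (hkn : ∀ s ∈ k, s < n)
    (h : walk n m a l = walk n m b k) : a = b ∧ l = k := by
  have h0 : a = b := by simpa [walk_zero] using congrFun h 0
  refine ⟨h0, List.ext_getElem (hl.trans hk.symm) fun i h1 h2 => ?_⟩
  have e1 := walk_succ a ⟨i, hl ▸ h1⟩ h1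
  rw [h, walk_succ b ⟨i, hl ▸ h1⟩ h2, add_right_inj, ZMod.natCast_eq_natCast_iff',
    Nat.mod_eq_of_lt (hkn _ (List.getElem_mem _)), Nat.mod_eq_of_lt (hln _ (List.getElem_mem _))]
    at e1
  exact e1.symm

theorem insertNth_walk_zero {m : ℕ} (a : ZMod n) (s : ℕ) (l : List ℕ) :
    Fin.insertNth (α := fun _ => ZMod n) 0 (a - s) (walk n m a l) =
      walk n (m + 1) (a - s) (s :: l) := by
  rw [Fin.insertNth_eq_iff]
  refine ⟨by simp [walk_zero], ?_⟩
  funext k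
  simp [Fin.removeNth, walk, ← add_assoc]

theorem insertNth_walk_last {m : ℕ} (a : ZMod n) (s : ℕ) {l : List ℕ} (hl : l.length = m) :
    Fin.insertNth (α := fun _ => ZMod n) (Fin.last (m + 1))
      (walk n m a l (Fin.last m) + s) (walk n m a l) = walk n (m + 1) a (l ++ [s]) := by
  rw [Fin.insertNth_eq_iff]
  constructor
  · simp [walk, ← hl, List.take_append, add_assoc,
      List.take_of_length_le (l := l) (Nat.le_succ _)]
  · funext k
    have hk : (k : ℕ) - l.length = 0 := by omega
    simp [Fin.removeNth, walk, List.take_append, hk]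

theorem insertNth_walk_append {m : ℕ} (a : ZMod n) {s t r : ℕ} (hst : ((s + t : ℕ) : ZMod n) = r)
    {l₁ l₂ : List ℕ} {i : Fin m} (hi : (i : ℕ) = l₁.length) :
    Fin.insertNth (α := fun _ => ZMod n) i.succ.castSucc
      (walk n m a (l₁ ++ r :: l₂) i.castSucc + s) (walk n m a (l₁ ++ r :: l₂)) =
      walk n (m + 1) a (l₁ ++ s :: t :: l₂) := by
  rw [Fin.insertNth_eq_iff]
  constructor
  · simp [walk, hi, List.take_append, add_assoc,
      List.take_of_length_le (l := l₁) (Nat.le_succ _)]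
  · funext k
    simp only [Fin.removeNth]
    rcases le_or_gt (k : ℕ) i with h | h
    · rw [Fin.succAbove_of_castSucc_lt _ _ (by simp [Fin.lt_def]; omega)]
      have e : (k : ℕ) - l₁.length = 0 := by omega
      simp [walk, List.take_append, e]
    · rw [Fin.succAbove_of_le_castSucc _ _ (by simp [Fin.le_def]; omega)]
      obtain ⟨q, hq⟩ : ∃ q, (k : ℕ) = l₁.length + (q + 1) := ⟨k - l₁.length - 1, by omega⟩
      have e : l₁.length + (q + 1) + 1 - l₁.length = q + 2 := by omega
      have e2 : l₁.length + (q + 1) - l₁.length = q + 1 := by omega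
      simp only [walk, Fin.val_succ, hq, List.take_append, e, e2, List.take_succ_cons]
      rw [List.take_of_length_le (l := l₁) (Nat.le_add_right _ (q + 1)),
        List.take_of_length_le (l := l₁) (by omega : l₁.length ≤ l₁.length + (q + 1) + 1)]
      push_cast at hst
      simp [← hst, add_assoc]

theorem stepPath_eq (K : Type*) [Field K] {m : ℕ} (a : ZMod n) (w : Fin m → ℕ) :
    stepPath K n a w = (irregular K (ZMod n) m).mkQ (elem K (walk n m a (List.ofFn w))) := by
  unfold stepPath
  congr 2
  funext i
  simp only [walk, Fin.partialSum]
  congr 1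
  rw [Nat.cast_list_sum, List.map_take, List.map_ofFn]
  rfl

end Walks

/-! ### The steps 1, 2, z and allowed walks -/

section Letters

/-- The steps `1, 2, z` as natural numbers. -/
def letters (z : ℕ) : Finset ℕ := {1, 2, z}

/-- The circulant digraph on `ℤ/n` with steps `1, 2, z`. -/
abbrev stepGraph (n z : ℕ) : Digraph (ZMod n) := circulant n {1, 2, (z : ZMod n)}

variable {n z : ℕ}

theorem letters_bounds (hz : z = 4 ∨ z = 5) {s : ℕ} (hs : s ∈ letters z) : 1 ≤ s ∧ s ≤ 5 := by
  simp only [letters, Finset.mem_insert, Finset.mem_singleton] at hs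
  omega

theorem letters_lt (hz : z = 4 ∨ z = 5) (hn : 10 < n) {l : List ℕ} (hl : ∀ s ∈ l, s ∈ letters z) :
    ∀ s ∈ l, s < n := fun s hs => by
  have := letters_bounds hz (hl s hs)
  omega

theorem stepGraph_adj {a b : ZMod n} :
    (stepGraph n z).Adj a b ↔ ∃ s ∈ letters z, b = a + (s : ℕ) := by
  simp [stepGraph, circulant, letters]

theorem natCast_inj {i j : ℕ} (hi : i < n) (hj : j < n) : (i : ZMod n) = j ↔ i = j := by
  rw [ZMod.natCast_eq_natCast_iff', Nat.mod_eq_of_lt hi, Nat.mod_eq_of_lt hj]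

theorem add_letter_injOn (hz : z = 4 ∨ z = 5) (hn : 10 < n) (y : ZMod n) :
    Set.InjOn (fun s : ℕ => y + (s : ZMod n)) (letters z) := by
  intro s hs t ht h
  have h1 := letters_bounds hz hs
  have h2 := letters_bounds hz ht
  exact (natCast_inj (by omega) (by omega)).1 (add_left_cancel h)

theorem sum_eq_sum_letters {K : Type*} [Field K] [NeZero n] (hz : z = 4 ∨ z = 5) (hn : 10 < n)
    (y : ZMod n) (f : ZMod n → K) (h : ∀ x, f x ≠ 0 → ∃ s ∈ letters z, x = y + (s : ℕ)) :
    ∑ x, f x = ∑ s ∈ letters z, f (y + (s : ℕ)) := by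
  rw [← Finset.sum_image (f := f) (add_letter_injOn hz hn y)]
  refine (Finset.sum_subset (Finset.subset_univ _) fun x _ hx => ?_).symm
  by_contra hf
  obtain ⟨s, hs, rfl⟩ := h x hf
  exact hx (Finset.mem_image_of_mem _ hs)

theorem walk_not_irregular {m : ℕ} (a : ZMod n) {l : List ℕ}
    (hm : l.length = m) (hl : ∀ s ∈ l, 0 < s ∧ s < n) : ¬ IsIrregular (walk n m a l) := by
  rintro ⟨i, hi⟩
  have hil : (i : ℕ) < l.length := hm ▸ i.2
  rw [walk_succ a i hil, left_eq_add] at hi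
  have h := hl _ (List.getElem_mem hil)
  have := (natCast_inj (n := n) (i := l[(i : ℕ)]) (j := 0) h.2 (by omega)).1 (by simpa using hi)
  omega

theorem letters_pos_lt (hz : z = 4 ∨ z = 5) (hn : 10 < n) {l : List ℕ}
    (hl : ∀ s ∈ l, s ∈ letters z) : ∀ s ∈ l, 0 < s ∧ s < n := fun s hs => by
  have := letters_bounds hz (hl s hs)
  omega

theorem walk_isAllowed {m : ℕ} (a : ZMod n) {l : List ℕ}
    (hm : l.length = m) (hl : ∀ s ∈ l, s ∈ letters z) : IsAllowed (stepGraph n z) (walk n m a l) := by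
  intro i
  have hil : (i : ℕ) < l.length := hm ▸ i.2
  exact stepGraph_adj.2 ⟨l[(i : ℕ)], hl _ (List.getElem_mem hil), walk_succ a i hil⟩

theorem letter_of_adj (hz : z = 4 ∨ z = 5) (hn : 10 < n) {a : ZMod n} {r : ℕ} (hr : r < n)
    (h : (stepGraph n z).Adj a (a + (r : ℕ))) : r ∈ letters z := by
  obtain ⟨s, hs, e⟩ := stepGraph_adj.1 h
  have := letters_bounds hz hs
  rwa [(natCast_inj hr (by omega)).1 (add_left_cancel e)]

theorem letters_of_isAllowed (hz : z = 4 ∨ z = 5) (hn : 10 < n) {m : ℕ} {a : ZMod n} {l : List ℕ}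
    (hm : l.length = m) (hl : ∀ s ∈ l, s < n) (h : IsAllowed (stepGraph n z) (walk n m a l)) :
    ∀ s ∈ l, s ∈ letters z := by
  intro s hs
  obtain ⟨i, hi, rfl⟩ := List.getElem_of_mem hs
  have := h ⟨i, hm ▸ hi⟩
  rw [walk_succ a _ hi] at this
  exact letter_of_adj hz hn (hl _ hs) this

end Letters

/-! ### Inserting a vertex at the start, at the end, or inside a step -/

section Insertion

variable {K : Type*} [Field K] {n z m : ℕ} [NeZero n]

theorem sum_insert_first (hz : z = 4 ∨ z = 5) (hn : 10 < n) {x : Reg K (ZMod n) (m + 1)}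
    (hx : x ∈ allowed K (stepGraph n z) (m + 1)) (a : ZMod n) (l : List ℕ) :
    ∑ y : ZMod n, coef (Fin.insertNth (α := fun _ => ZMod n) 0 y (walk n m a l)) x =
      ∑ s ∈ letters z, coef (walk n (m + 1) (a - (s : ℕ)) (s :: l)) x := by
  rw [← Equiv.sum_comp (Equiv.neg (ZMod n)), sum_eq_sum_letters hz hn (-a)]
  · refine Finset.sum_congr rfl fun s _ => ?_
    rw [← insertNth_walk_zero]
    congr 3
    simp [sub_eq_add_neg, add_comm]
  · intro y hy
    by_contra hcon
    refine hy (mem_allowed_iff.1 hx _ fun h => hcon ?_)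
    have := h 0
    rw [stepGraph_adj] at this
    obtain ⟨s, hs, e⟩ := this
    refine ⟨s, hs, ?_⟩
    simp [walk_zero] at e
    rw [e]
    abel

theorem sum_insert_last (hz : z = 4 ∨ z = 5) (hn : 10 < n) {x : Reg K (ZMod n) (m + 1)}
    (hx : x ∈ allowed K (stepGraph n z) (m + 1)) (a : ZMod n) {l : List ℕ} (hl : l.length = m) :
    ∑ y : ZMod n, coef (Fin.insertNth (α := fun _ => ZMod n) (Fin.last (m + 1)) y (walk n m a l)) x =
      ∑ s ∈ letters z, coef (walk n (m + 1) a (l ++ [s])) x := by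
  rw [sum_eq_sum_letters hz hn (walk n m a l (Fin.last m))]
  · exact Finset.sum_congr rfl fun s _ => by rw [insertNth_walk_last a s hl]
  · intro y hy
    by_contra hcon
    refine hy (mem_allowed_iff.1 hx _ fun h => hcon ?_)
    have := h (Fin.last m)
    rw [stepGraph_adj] at this
    obtain ⟨s, hs, e⟩ := this
    refine ⟨s, hs, ?_⟩
    simpa using e

theorem sum_insert_append (hz : z = 4 ∨ z = 5) (hn : 10 < n) {x : Reg K (ZMod n) (m + 1)}
    (hx : x ∈ allowed K (stepGraph n z) (m + 1)) (a : ZMod n) {l₁ l₂ : List ℕ} {r : ℕ} (hr : r < n)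
    {i : Fin m} (hi : (i : ℕ) = l₁.length) :
    ∑ y : ZMod n, coef (Fin.insertNth (α := fun _ => ZMod n) i.succ.castSucc y
        (walk n m a (l₁ ++ r :: l₂))) x =
      ∑ s ∈ letters z, ∑ t ∈ letters z,
        if s + t = r then coef (walk n (m + 1) a (l₁ ++ s :: t :: l₂)) x else 0 := by
  have hv : ∀ y : ZMod n, IsAllowed (stepGraph n z) (Fin.insertNth (α := fun _ => ZMod n)
      i.succ.castSucc y (walk n m a (l₁ ++ r :: l₂))) →
      (∃ s ∈ letters z, y = walk n m a (l₁ ++ r :: l₂) i.castSucc + (s : ℕ)) ∧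
      (∃ t ∈ letters z, walk n m a (l₁ ++ r :: l₂) i.castSucc + (r : ℕ) = y + (t : ℕ)) := by
    intro y h
    have h1 := h i.castSucc
    have h2 := h i.succ
    have e0 : i.castSucc.castSucc = (i.succ.castSucc).succAbove i.castSucc := by
      rw [Fin.succAbove_of_castSucc_lt _ _ (by simp [Fin.lt_def])]
    have e1 : i.castSucc.succ = i.succ.castSucc := by ext; simp
    have e2 : i.succ.succ = (i.succ.castSucc).succAbove i.succ := by
      rw [Fin.succAbove_of_le_castSucc _ _ (by simp)]
    rw [e1, e0, Fin.insertNth_apply_same, Fin.insertNth_apply_succAbove, stepGraph_adj] at h1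
    rw [e2, Fin.insertNth_apply_same, Fin.insertNth_apply_succAbove, stepGraph_adj,
      walk_succ _ _ (by simp [hi])] at h2
    simp only [hi, List.getElem_append_right le_rfl, Nat.sub_self, List.getElem_cons_zero] at h2
    exact ⟨h1, h2⟩
  rw [sum_eq_sum_letters hz hn (walk n m a (l₁ ++ r :: l₂) i.castSucc)]
  · refine Finset.sum_congr rfl fun s hs => ?_
    have hsb := letters_bounds hz hs
    by_cases hex : ∃ t ∈ letters z, s + t = r
    · obtain ⟨t, ht, hst⟩ := hex
      rw [Finset.sum_eq_single t, if_pos hst, insertNth_walk_append a (by rw [hst]) hi]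
      · intro u _ hu
        rw [if_neg (by omega)]
      · exact fun h => absurd ht h
    · rw [Finset.sum_eq_zero]
      · refine mem_allowed_iff.1 hx _ fun h => hex ?_
        obtain ⟨t, ht, e⟩ := (hv _ h).2
        refine ⟨t, ht, ?_⟩
        have htb := letters_bounds hz ht
        rw [add_assoc, add_right_inj] at e
        -- The full bound `n > 10` enters here: `s + t ≤ 10` turns the congruence into an equality.
        exact ((natCast_inj (n := n) hr (by omega)).1 (by push_cast; exact e)).symm
      · intro t ht
        rw [if_neg fun e => hex ⟨t, ht, e⟩]
  · intro y hy
    by_contra hcon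
    exact hy (mem_allowed_iff.1 hx _ fun h => hcon (hv y h).1)

/-- The boundary coefficient at a path with a step that is not a letter. -/
theorem coef_boundary_append (hz : z = 4 ∨ z = 5) (hn : 10 < n) {x : Reg K (ZMod n) (m + 1)}
    (hx : x ∈ allowed K (stepGraph n z) (m + 1)) (a : ZMod n) {l₁ l₂ : List ℕ} {r : ℕ} (hr : r < n)
    (hrz : r ∉ letters z) (hm : l₁.length + l₂.length + 1 = m)
    (hv : ¬ IsIrregular (walk n m a (l₁ ++ r :: l₂))) :
    coef (walk n m a (l₁ ++ r :: l₂)) (boundary K (ZMod n) m x) =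
      (-1) ^ (l₁.length + 1) * ∑ s ∈ letters z, ∑ t ∈ letters z,
        if s + t = r then coef (walk n (m + 1) a (l₁ ++ s :: t :: l₂)) x else 0 := by
  have hi : l₁.length < m := by omega
  rw [coef_boundary hv, Finset.sum_eq_single (Fin.succ ⟨l₁.length, hi⟩).castSucc,
    sum_insert_append hz hn hx a hr (by rfl)]
  · simp
  · intro j _ hj
    -- An insertion elsewhere leaves the forbidden step `r` in place, so the longer path is not
    -- allowed.
    rw [Finset.sum_eq_zero, mul_zero]
    intro y _
    refine mem_allowed_iff.1 hx _ fun h => hrz ?_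
    have := h.adj_of_ne (j := j) (i := ⟨l₁.length, hi⟩) fun e => hj (Fin.ext (by simpa using e))
    rw [Fin.insertNth_apply_succAbove, Fin.insertNth_apply_succAbove,
      walk_succ _ _ (by simp)] at this
    simp only [List.getElem_append_right le_rfl, Nat.sub_self, List.getElem_cons_zero] at this
    exact letter_of_adj hz hn hr this
  · simp

end Insertion

/-! ### Membership in Ω as sign alternation, and sorting of words -/

section Alternating

variable {K : Type*} [Field K] {n z m : ℕ}

/-- `f` changes sign when two neighbouring letters whose sum is not a letter are exchanged. -/
def IsAlternating (z m : ℕ) (f : List ℕ → K) : Prop :=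
  ∀ l₁ l₂ : List ℕ, ∀ s t : ℕ, (∀ r ∈ l₁, r ∈ letters z) → (∀ r ∈ l₂, r ∈ letters z) →
    s ∈ letters z → t ∈ letters z → s + t ∉ letters z → l₁.length + l₂.length + 2 = m →
    f (l₁ ++ s :: t :: l₂) + f (l₁ ++ t :: s :: l₂) = 0

/-- The sums of unordered pairs of letters are pairwise distinct, for {1, 2, 4} as for {1, 2, 5}; a
double letter contributes one term instead of two. -/
theorem sum_pairs (hz : z = 4 ∨ z = 5) (F : ℕ → ℕ → K) {s t : ℕ} (hs : s ∈ letters z)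
    (ht : t ∈ letters z) :
    (∑ s' ∈ letters z, ∑ t' ∈ letters z, if s' + t' = s + t then F s' t' else 0) =
      if s = t then F s s else F s t + F t s := by
  rcases hz with rfl | rfl <;>
  · simp only [letters, Finset.mem_insert, Finset.mem_singleton] at hs ht
    rcases hs with rfl | rfl | rfl <;> rcases ht with rfl | rfl | rfl <;>
      simp [letters, add_comm]

/-- The coefficient of `∂x` at a path with a single forbidden step `s + t` is, up to sign, the sum
over the two orders of `s, t`, or one term if `s = t`. With further forbidden steps it vanishes by
itself. -/
theorem mem_Omega_iff [CharZero K] [NeZero n] (hz : z = 4 ∨ z = 5) (hn : 10 < n)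
    {x : Reg K (ZMod n) m} (hx : x ∈ allowed K (stepGraph n z) m) :
    x ∈ Omega K (stepGraph n z) m ↔
      ∀ a, IsAlternating z m fun l => coef (walk n m a l) x := by
  rcases m with _ | m
  -- In degree 0 there is no pair of neighbouring letters, so alternation is vacuous.
  · refine ⟨fun _ a l₁ l₂ s t _ _ _ _ _ h => by omega, fun _ => hx⟩
  constructor
  · intro hxO a l₁ l₂ s t h1 h2 hs ht hst hm
    have hsb := letters_bounds hz hs
    have htb := letters_bounds hz ht
    have hreg : ¬ IsIrregular (walk n m a (l₁ ++ (s + t) :: l₂)) := by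
      refine walk_not_irregular a (by simp; omega) fun r hr => ?_
      rcases List.mem_append.1 hr with hr | hr
      · exact letters_pos_lt hz hn h1 r hr
      · rcases List.mem_cons.1 hr with rfl | hr
        · omega
        · exact letters_pos_lt hz hn h2 r hr
    have hb := coef_boundary_append hz hn hx a (l₁ := l₁) (l₂ := l₂) (r := s + t) (by omega) hst
      (by omega) hreg
    rw [mem_allowed_iff.1 hxO.2, sum_pairs hz (fun s t => coef (walk n (m + 1) a _) x) hs ht] at hb
    · have h0 := (mul_eq_zero.1 hb.symm).resolve_left (pow_ne_zero _ (by simp))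
      split_ifs at h0 with e
      · subst e
        simp only at h0 ⊢
        rw [h0, add_zero]
      · exact h0
    · intro hal
      have hil : l₁.length < m := by omega
      have := hal ⟨l₁.length, hil⟩
      rw [walk_succ _ _ (by simp)] at this
      simp only [List.getElem_append_right le_rfl, Nat.sub_self, List.getElem_cons_zero] at this
      exact hst (letter_of_adj hz hn (by omega) this)
  · intro h
    refine ⟨hx, mem_allowed_iff.2 fun v hv => ?_⟩
    by_cases hreg : IsIrregular v
    · exact coef_of_irregular hreg _
    obtain ⟨l, hl, hln, e⟩ := exists_eq_walk v
    rw [e] at hv hreg ⊢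
    generalize v 0 = a at *
    have hex : ∃ r ∈ l, r ∉ letters z := by
      by_contra! hcon
      exact hv (walk_isAllowed a hl hcon)
    obtain ⟨r, hr, hrz⟩ := hex
    have hrn := hln r hr
    obtain ⟨l₁, l₂, rfl⟩ := List.append_of_mem hr
    simp only [List.length_append, List.length_cons] at hl
    rw [coef_boundary_append hz hn hx a hrn hrz (by omega) hreg]
    refine mul_eq_zero_of_right _ ?_
    by_cases hlet : (∀ q ∈ l₁, q ∈ letters z) ∧ (∀ q ∈ l₂, q ∈ letters z)
    · by_cases hst : ∃ s ∈ letters z, ∃ t ∈ letters z, s + t = r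
      · obtain ⟨s, hs, t, ht, rfl⟩ := hst
        rw [sum_pairs hz (fun s t => coef (walk n (m + 1) a _) x) hs ht]
        have := h a l₁ l₂ s t hlet.1 hlet.2 hs ht hrz (by omega)
        split_ifs with e
        · subst e
          -- For `s = t` alternation says that twice the coefficient is zero.
          exact self_eq_neg.1 (eq_neg_of_add_eq_zero_left this)
        · exact this
      · refine Finset.sum_eq_zero fun s hs => Finset.sum_eq_zero fun t ht => ?_
        rw [if_neg fun e => hst ⟨s, hs, t, ht, e⟩]
    -- A second forbidden step survives the splitting of `r`, so no path in the sum is allowed.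
    · refine Finset.sum_eq_zero fun s hs => Finset.sum_eq_zero fun t ht => ?_
      split_ifs
      · refine mem_allowed_iff.1 hx _ fun hal => hlet ?_
        have hsb := letters_bounds hz hs
        have htb := letters_bounds hz ht
        have := letters_of_isAllowed hz hn (by simp; omega) (fun q hq => ?_) hal
        · exact ⟨fun q hq => this q (by simp [hq]), fun q hq => this q (by simp [hq])⟩
        · simp only [List.mem_append, List.mem_cons] at hq
          rcases hq with hq | rfl | rfl | hq
          · exact hln q (by simp [hq])
          · omega
          · omega
          · exact hln q (by simp [hq])
      · rfl

/-- The number of inversions of a word written as a list. -/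
def inv : List ℕ → ℕ
  | [] => 0
  | s :: l => l.countP (· < s) + inv l

theorem neg_one_pow_inv_swap {s t : ℕ} (hst : s ≠ t) (l₁ l₂ : List ℕ) :
    (-1 : K) ^ inv (l₁ ++ s :: t :: l₂) = -(-1) ^ inv (l₁ ++ t :: s :: l₂) := by
  induction l₁ with
  | nil =>
    rcases lt_or_gt_of_ne hst with h | h
    · simp only [List.nil_append, inv, List.countP_cons, h, not_lt.2 h.le, decide_true, decide_false,
        pow_add]
      simp
      ring
    · simp only [List.nil_append, inv, List.countP_cons, h, not_lt.2 h.le, decide_true, decide_false,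
        pow_add]
      simp
      ring
  | cons r l ih =>
    have hp : (l ++ s :: t :: l₂).countP (· < r) = (l ++ t :: s :: l₂).countP (· < r) :=
      (List.Perm.append_left l (List.Perm.swap t s l₂)).countP_eq _
    simp only [List.cons_append, inv, pow_add, hp, ih]
    ring

/-- Every other letter is inverted with both copies of `s` or with neither. -/
theorem neg_one_pow_inv_double (s : ℕ) (l₁ l₂ : List ℕ) :
    (-1 : K) ^ inv (l₁ ++ s :: s :: l₂) = (-1) ^ inv (l₁ ++ l₂) := by
  induction l₁ with
  | nil =>
    simp only [List.nil_append, inv, List.countP_cons, lt_irrefl, decide_false]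
    simp only [Bool.false_eq_true, if_false, add_zero, pow_add, ← mul_assoc, ← mul_pow]
    simp
  | cons r l ih =>
    simp only [List.cons_append, inv, pow_add, ih, List.countP_append, List.countP_cons]
    split_ifs <;> simp

theorem inv_eq_zero {l : List ℕ} (h : l.Pairwise (· ≤ ·)) : inv l = 0 := by
  induction l with
  | nil => rfl
  | cons s l ih =>
    rw [List.pairwise_cons] at h
    rw [inv, ih h.2, add_zero, List.countP_eq_zero]
    intro t ht
    simpa using h.1 t ht

theorem inversions_eq_inv {m : ℕ} (w : Fin m → ℕ) : inversions w = inv (List.ofFn w) := by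
  induction m with
  | zero => simp [inversions, inv]
  | succ m ih =>
    rw [List.ofFn_succ, inv, ← ih]
    unfold inversions
    have hcount : (List.ofFn fun i : Fin m => w i.succ).countP (· < w 0) =
        Finset.card {i : Fin m | w i.succ < w 0} := by
      rw [← Multiset.coe_countP, ← Fin.univ_val_map, Multiset.countP_map]
      rfl
    rw [hcount, Finset.card_filter, Finset.card_filter, Finset.card_filter,
      ← Finset.univ_product_univ, ← Finset.univ_product_univ, Finset.sum_product,
      Finset.sum_product, Fin.sum_univ_succ]
    congr 1
    · rw [Fin.sum_univ_succ]
      simp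
    · refine Finset.sum_congr rfl fun i _ => ?_
      rw [Fin.sum_univ_succ]
      simp

/-- Sorted insertion carries `s` past each smaller letter, one sign per swap. The prefix `l₁` is
kept arbitrary so that the induction can move letters into it. -/
theorem IsAlternating.orderedInsert (hz : z = 4 ∨ z = 5) {f : List ℕ → K} (hf : IsAlternating z m f)
    {s : ℕ} (hs : s ∈ letters z) (k : List ℕ) :
    ∀ l₁ : List ℕ, (∀ r ∈ l₁, r ∈ letters z) → (∀ r ∈ k, r ∈ letters z) → k.Pairwise (· ≤ ·) →
      l₁.length + k.length + 1 = m →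
      f (l₁ ++ s :: k) = (-1) ^ k.countP (· < s) * f (l₁ ++ k.orderedInsert (· ≤ ·) s) := by
  induction k with
  | nil => simp
  | cons b k ih =>
    intro l₁ h1 hk hp hm
    rw [List.orderedInsert_cons]
    split_ifs with hsb
    · have : (b :: k).countP (· < s) = 0 := by
        rw [List.countP_eq_zero]
        intro t ht
        rcases List.mem_cons.1 ht with rfl | ht
        · simpa using hsb
        · simpa using hsb.trans ((List.pairwise_cons.1 hp).1 t ht)
      simp [this]
    · have hb : b ∈ letters z := hk b (by simp)
      -- Here `b < s`, and distinct letters have sums 3, 5, 6 or 3, 6, 7, none of them a letter.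
      have hsum : s + b ∉ letters z := by
        simp only [letters, Finset.mem_insert, Finset.mem_singleton] at hs hb ⊢
        omega
      have hsw := hf l₁ k s b h1 (fun r hr => hk r (by simp [hr])) hs hb hsum
        (by simp at hm; omega)
      have := ih (l₁ ++ [b]) (by simpa [or_imp, forall_and] using ⟨h1, hb⟩)
        (fun r hr => hk r (by simp [hr])) (List.pairwise_cons.1 hp).2 (by simp at hm ⊢; omega)
      simp only [List.append_assoc, List.cons_append, List.nil_append] at this
      rw [eq_neg_of_add_eq_zero_left hsw, this, List.countP_cons, if_pos (by simpa using hsb)]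
      ring

theorem IsAlternating.insertionSort (hz : z = 4 ∨ z = 5) {f : List ℕ → K}
    (hf : IsAlternating z m f) (l : List ℕ) :
    ∀ l₁ : List ℕ, (∀ r ∈ l₁, r ∈ letters z) → (∀ r ∈ l, r ∈ letters z) →
      l₁.length + l.length = m →
      f (l₁ ++ l) = (-1) ^ inv l * f (l₁ ++ l.insertionSort (· ≤ ·)) := by
  induction l with
  | nil => simp [inv]
  | cons s l ih =>
    intro l₁ h1 hl hm
    have hs : s ∈ letters z := hl s (by simp)
    have := ih (l₁ ++ [s]) (by simpa [or_imp, forall_and] using ⟨h1, hs⟩)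
      (fun r hr => hl r (by simp [hr])) (by simp at hm ⊢; omega)
    simp only [List.append_assoc, List.cons_append, List.nil_append] at this
    rw [this, hf.orderedInsert hz hs _ l₁ h1
      (fun r hr => hl r (by simpa using Or.inr ((List.mem_insertionSort _).1 hr)))
      (List.pairwise_insertionSort _ l) (by simp at hm ⊢; omega), List.insertionSort_cons,
      (List.perm_insertionSort _ l).countP_eq, inv]
    ring

/-- The sorted word with `p` letters `1`, `q` letters `2` and `r` letters `z`. -/
def sortedWord (z p q r : ℕ) : List ℕ :=
  List.replicate p 1 ++ (List.replicate q 2 ++ List.replicate r z)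

theorem length_sortedWord (z p q r : ℕ) : (sortedWord z p q r).length = p + q + r := by
  simp [sortedWord, add_assoc]

theorem letters_sortedWord (z p q r : ℕ) : ∀ s ∈ sortedWord z p q r, s ∈ letters z := by
  intro s hs
  simp only [sortedWord, List.mem_append, List.mem_replicate] at hs
  simp only [letters, Finset.mem_insert, Finset.mem_singleton]
  tauto

theorem pairwise_sortedWord (hz : z = 4 ∨ z = 5) (p q r : ℕ) :
    (sortedWord z p q r).Pairwise (· ≤ ·) := by
  simp only [sortedWord, List.pairwise_append, List.mem_append, List.mem_replicate,
    List.pairwise_replicate]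
  refine ⟨by simp, ⟨by simp, by simp, ?_⟩, ?_⟩
  · rintro a ⟨-, rfl⟩ b ⟨-, rfl⟩
    omega
  · rintro a ⟨-, rfl⟩ b (⟨-, rfl⟩ | ⟨-, rfl⟩) <;> omega

theorem IsAlternating.eq_sortedWord (hz : z = 4 ∨ z = 5) {f : List ℕ → K}
    (hf : IsAlternating z m f) {l : List ℕ} {p q r : ℕ} (hl : l.Perm (sortedWord z p q r))
    (hm : p + q + r = m) : f l = (-1) ^ inv l * f (sortedWord z p q r) := by
  have h := hf.insertionSort hz l [] (by simp)
    (fun s hs => letters_sortedWord z p q r s (hl.subset hs))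
    (by rw [List.length_nil, hl.length_eq, length_sortedWord]; omega)
  rw [List.nil_append, List.nil_append] at h
  rw [h, ((List.perm_insertionSort _ l).trans hl).eq_of_pairwise (fun a b _ _ => le_antisymm)
    (List.pairwise_insertionSort _ l) (pairwise_sortedWord hz p q r)]

theorem exists_perm_sortedWord (hz : z = 4 ∨ z = 5) {l : List ℕ} (hl : ∀ s ∈ l, s ∈ letters z) :
    ∃ p q r, l.Perm (sortedWord z p q r) := by
  induction l with
  | nil => exact ⟨0, 0, 0, by simp [sortedWord]⟩
  | cons s l ih =>
    obtain ⟨p, q, r, h⟩ := ih fun s hs => hl s (by simp [hs])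
    have hs := hl s (by simp)
    simp only [letters, Finset.mem_insert, Finset.mem_singleton] at hs
    rcases hs with rfl | rfl | rfl
    · exact ⟨p + 1, q, r, h.cons 1⟩
    · exact ⟨p, q + 1, r, (h.cons 2).trans List.perm_middle.symm⟩
    · refine ⟨p, q, r + 1, (h.cons s).trans ?_⟩
      rw [sortedWord, ← List.append_assoc]
      exact List.perm_middle.symm.trans (by simp [sortedWord, List.replicate_succ])

/-- The multiplicities `1^p 2^q z^r` for which the letters `z`, and `2` if `z = 5`, do not repeat. -/
def IsAdmissible (z q r : ℕ) : Prop := r ≤ 1 ∧ (z = 5 → q ≤ 1)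

/-- A repeated letter whose double is not a letter can be swapped with its own copy, so the
coefficient equals its negative. -/
theorem IsAlternating.sortedWord_eq_zero [CharZero K] (hz : z = 4 ∨ z = 5) {f : List ℕ → K}
    (hf : IsAlternating z m f) {p q r : ℕ} (h : ¬ IsAdmissible z q r) (hm : p + q + r = m) :
    f (sortedWord z p q r) = 0 := by
  have hrep : ∀ s k : ℕ, s ∈ letters z → ∀ r ∈ List.replicate k s, r ∈ letters z :=
    fun s k hs r hr => by rwa [List.eq_of_mem_replicate hr]
  have h1 : 1 ∈ letters z := by simp [letters]
  have h2 : 2 ∈ letters z := by simp [letters]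
  have h3 : z ∈ letters z := by simp [letters]
  by_cases hr : r ≤ 1
  · have hz5 : z = 5 ∧ 2 ≤ q := by
      by_contra hcon
      exact h ⟨hr, fun e => by omega⟩
    obtain ⟨rfl, hq⟩ := hz5
    obtain ⟨q, rfl⟩ := Nat.exists_eq_add_of_le' hq
    have := hf (List.replicate p 1) (List.replicate q 2 ++ List.replicate r 5) 2 2 (hrep 1 _ h1)
      (by
        intro s hs
        rcases List.mem_append.1 hs with hs | hs
        · exact hrep 2 _ h2 s hs
        · exact hrep 5 _ h3 s hs) h2 h2 (by simp [letters]) (by simp; omega)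
    exact self_eq_neg.1 (eq_neg_of_add_eq_zero_left this)
  · obtain ⟨r, rfl⟩ := Nat.exists_eq_add_of_le' (not_le.1 hr)
    have := hf (List.replicate p 1 ++ List.replicate q 2) (List.replicate r z) z z
      (by
        intro s hs
        rcases List.mem_append.1 hs with hs | hs
        · exact hrep 1 _ h1 s hs
        · exact hrep 2 _ h2 s hs) (hrep z _ h3) h3 h3
      (by simp [letters]; omega) (by simp; omega)
    rw [List.append_assoc] at this
    exact self_eq_neg.1 (eq_neg_of_add_eq_zero_left this)

end Alternating

/-! ### Inversions and multiplicities of sorted words -/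

section Words

variable {z : ℕ}

theorem inv_append_singleton (l : List ℕ) (s : ℕ) :
    inv (l ++ [s]) = inv l + l.countP (s < ·) := by
  induction l with
  | nil => simp [inv]
  | cons t l ih =>
    simp only [List.cons_append, inv, ih, List.countP_append, List.countP_cons, List.countP_nil]
    omega

theorem countP_sortedWord (f : ℕ → Bool) (p q r : ℕ) : (sortedWord z p q r).countP f =
    (if f 1 then p else 0) + ((if f 2 then q else 0) + if f z then r else 0) := by
  simp [sortedWord, List.countP_append, List.countP_replicate]

theorem inv_sortedWord (hz : z = 4 ∨ z = 5) (p q r : ℕ) : inv (sortedWord z p q r) = 0 :=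
  inv_eq_zero (pairwise_sortedWord hz p q r)

theorem perm_cons_one (p q r : ℕ) : (1 :: sortedWord z p q r).Perm (sortedWord z (p + 1) q r) :=
  List.Perm.refl _

theorem perm_cons_two (p q r : ℕ) : (2 :: sortedWord z p q r).Perm (sortedWord z p (q + 1) r) :=
  List.perm_middle.symm

theorem perm_cons_last (p q r : ℕ) : (z :: sortedWord z p q r).Perm (sortedWord z p q (r + 1)) := by
  rw [sortedWord, ← List.append_assoc]
  exact List.perm_middle.symm.trans (by simp [sortedWord, List.replicate_succ])

theorem count_sortedWord (hz : z = 4 ∨ z = 5) (p q r : ℕ) : (sortedWord z p q r).count 1 = p ∧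
    (sortedWord z p q r).count 2 = q ∧ (sortedWord z p q r).count z = r := by
  have h1 : ¬ z = 1 ∧ ¬ z = 2 ∧ ¬ 1 = z ∧ ¬ 2 = z := by omega
  simp [sortedWord, List.count_append, List.count_replicate, h1]

theorem sortedWord_coe_inj (hz : z = 4 ∨ z = 5) {p q r p' q' r' : ℕ} :
    (sortedWord z p q r : Multiset ℕ) = sortedWord z p' q' r' ↔ (p, q, r) = (p', q', r') := by
  constructor
  · intro h
    have hp := Multiset.coe_eq_coe.1 h
    have h1 := count_sortedWord hz p q r
    have h2 := count_sortedWord hz p' q' r'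
    simp only [hp.count_eq] at h1
    rw [← h1.1, ← h1.2.1, ← h1.2.2, h2.1, h2.2.1, h2.2.2]
  · intro h
    simp only [Prod.mk.injEq] at h
    rw [h.1, h.2.1, h.2.2]

end Words

/-! ### The boundary in sorted-word coordinates -/

section Coordinates

variable {K : Type*} [Field K] {n z m : ℕ}

/-- The coefficient of the path with start `a` and steps `1^p 2^q z^r`. -/
noncomputable def coord (z p q r : ℕ) (a : ZMod n) : Reg K (ZMod n) m →ₗ[K] K :=
  coef (walk n m a (sortedWord z p q r))

theorem coef_eq_coord [CharZero K] [NeZero n] (hz : z = 4 ∨ z = 5) (hn : 10 < n)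
    {x : Reg K (ZMod n) m} (hx : x ∈ Omega K (stepGraph n z) m) (a : ZMod n) {l : List ℕ}
    {p q r : ℕ} (hl : l.Perm (sortedWord z p q r)) (hm : p + q + r = m) :
    coef (walk n m a l) x = (-1) ^ inv l * coord z p q r a x :=
  ((mem_Omega_iff hz hn (Omega_le_allowed _ _ hx)).1 hx a).eq_sortedWord hz hl hm

theorem coord_eq_zero [CharZero K] [NeZero n] (hz : z = 4 ∨ z = 5) (hn : 10 < n)
    {x : Reg K (ZMod n) m} (hx : x ∈ Omega K (stepGraph n z) m) (a : ZMod n)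
    {p q r : ℕ} (h : ¬ IsAdmissible z q r) (hm : p + q + r = m) : coord z p q r a x = 0 :=
  ((mem_Omega_iff hz hn (Omega_le_allowed _ _ hx)).1 hx a).sortedWord_eq_zero hz h hm

theorem Omega_eq_zero [CharZero K] [NeZero n] (hz : z = 4 ∨ z = 5) (hn : 10 < n)
    {x : Reg K (ZMod n) m} (hx : x ∈ Omega K (stepGraph n z) m)
    (h : ∀ p q r a, p + q + r = m → IsAdmissible z q r → coord z p q r a x = 0) : x = 0 := by
  refine reg_ext fun v => ?_
  rw [map_zero]
  by_cases hv : IsAllowed (stepGraph n z) v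
  · obtain ⟨l, hl, hln, e⟩ := exists_eq_walk v
    rw [e] at hv ⊢
    have hll := letters_of_isAllowed hz hn hl hln hv
    obtain ⟨p, q, r, hp⟩ := exists_perm_sortedWord hz hll
    have hm : p + q + r = m := by rw [← length_sortedWord z, ← hp.length_eq, hl]
    rw [coef_eq_coord hz hn hx _ hp hm]
    by_cases hadm : IsAdmissible z q r
    · rw [h p q r _ hm hadm, mul_zero]
    · rw [coord_eq_zero hz hn hx _ hadm hm, mul_zero]
  · exact mem_allowed_iff.1 (Omega_le_allowed _ _ hx) v hv

theorem sum_pairs_letter (hz : z = 4 ∨ z = 5) (F : ℕ → ℕ → K) :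
    (∑ s ∈ letters z, ∑ t ∈ letters z, if s + t = 1 then F s t else 0) = 0 ∧
    (∑ s ∈ letters z, ∑ t ∈ letters z, if s + t = 2 then F s t else 0) = F 1 1 ∧
    (∑ s ∈ letters z, ∑ t ∈ letters z, if s + t = z then F s t else 0) =
      if z = 4 then F 2 2 else 0 := by
  rcases hz with rfl | rfl <;> simp [letters]

theorem sum_letters (hz : z = 4 ∨ z = 5) (F : ℕ → K) :
    ∑ s ∈ letters z, F s = F 1 + F 2 + F z := by
  rcases hz with rfl | rfl <;> simp [letters, add_assoc]

/-- Dropping both copies of `s` leaves a sublist of a sorted word, so splitting a letter into two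
equal halves costs no sign. -/
theorem inv_double_eq_zero (hz : z = 4 ∨ z = 5) {l₁ l₂ : List ℕ} {s t p q r : ℕ}
    (h : sortedWord z p q r = l₁ ++ t :: l₂) : (-1 : K) ^ inv (l₁ ++ s :: s :: l₂) = 1 := by
  rw [neg_one_pow_inv_double, inv_eq_zero, pow_zero]
  refine (h ▸ pairwise_sortedWord hz p q r).sublist ?_
  exact (List.Sublist.refl l₁).append (List.sublist_cons_self t l₂)

/-- The first three lines come from a letter put in front, which moves the starting vertex back, or
at the end; the signs count the letters it must pass to reach its block. The last two come from 2 =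
1 + 1 and 4 = 2 + 2. The truncated `q - 1` and `r - 1` occur only for odd, hence positive, `q` and
`r`. -/
theorem coord_boundary [CharZero K] [NeZero n] (hz : z = 4 ∨ z = 5) (hn : 10 < n)
    {x : Reg K (ZMod n) (m + 1)} (hx : x ∈ Omega K (stepGraph n z) (m + 1)) {p q r : ℕ}
    (hm : p + q + r = m) (a : ZMod n) :
    coord z p q r a (boundary K (ZMod n) m x) =
      (coord z (p + 1) q r (a - 1) x + (-1) ^ (p + 1) * coord z (p + 1) q r a x) +
      (-1) ^ p * (coord z p (q + 1) r (a - 2) x +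
        (-1) ^ (q + 1) * coord z p (q + 1) r a x) +
      (-1) ^ (p + q) * (coord z p q (r + 1) (a - (z : ZMod n)) x +
        (-1) ^ (r + 1) * coord z p q (r + 1) a x) +
      (if Even q then 0 else (-1) ^ (p + 1) * coord z (p + 2) (q - 1) r a x) +
      (if Even r then 0 else
        if z = 4 then (-1) ^ (p + q + 1) * coord z p (q + 2) (r - 1) a x else 0) := by
  have hxa := Omega_le_allowed _ _ hx
  have hlen : (sortedWord z p q r).length = m := by rw [length_sortedWord, hm]
  have hlet := letters_sortedWord z p q r
  have hz2 : (2 < z) ∧ (1 < z) := by omega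
  have hfirst := sum_insert_first hz hn hxa a (sortedWord z p q r)
  rw [sum_letters hz, coef_eq_coord hz hn hx _ (perm_cons_one p q r) (by omega),
    coef_eq_coord hz hn hx _ (perm_cons_two p q r) (by omega),
    coef_eq_coord hz hn hx _ (perm_cons_last p q r) (by omega)] at hfirst
  simp only [inv, countP_sortedWord, inv_sortedWord hz] at hfirst
  have hlast := sum_insert_last hz hn hxa a hlen
  rw [sum_letters hz, coef_eq_coord hz hn hx a
      ((List.perm_append_singleton _ _).trans (perm_cons_one p q r)) (by omega),
    coef_eq_coord hz hn hx a
      ((List.perm_append_singleton _ _).trans (perm_cons_two p q r)) (by omega),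
    coef_eq_coord hz hn hx a
      ((List.perm_append_singleton _ _).trans (perm_cons_last p q r)) (by omega)] at hlast
  simp only [inv_append_singleton, countP_sortedWord, inv_sortedWord hz] at hlast
  -- An insertion inside a letter of the word: 1 cannot be split, 2 only as 1 + 1, and `z` only as 2
  -- + 2 when `z = 4`. The value depends only on the block.
  have hmid : ∀ i : Fin m, ∑ y : ZMod n, coef (Fin.insertNth (α := fun _ => ZMod n) i.castSucc.succ y
      (walk n m a (sortedWord z p q r))) x = if (i : ℕ) < p then 0 else if (i : ℕ) < p + q then
        coord z (p + 2) (q - 1) r a x else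
          if z = 4 then coord z p (q + 2) (r - 1) a x else 0 := by
    intro i
    rw [Fin.succ_castSucc]
    split_ifs with h1 h2 h4
    · obtain ⟨k, rfl⟩ : ∃ k, p = i + (k + 1) := ⟨p - i - 1, by omega⟩
      have e : sortedWord z (i + (k + 1)) q r = List.replicate i 1 ++ 1 ::
          (List.replicate k 1 ++ (List.replicate q 2 ++ List.replicate r z)) := by
        rw [sortedWord, List.replicate_add, List.replicate_succ]
        simp
      rw [e, sum_insert_append hz hn hxa a (by omega) (by simp)]
      exact (sum_pairs_letter hz _).1
    · obtain ⟨j, hj⟩ : ∃ j, (i : ℕ) = p + j := ⟨i - p, by omega⟩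
      obtain ⟨k, rfl⟩ : ∃ k, q = j + (k + 1) := ⟨q - j - 1, by omega⟩
      have e : sortedWord z p (j + (k + 1)) r = (List.replicate p 1 ++ List.replicate j 2) ++ 2 ::
          (List.replicate k 2 ++ List.replicate r z) := by
        rw [sortedWord, List.replicate_add, List.replicate_succ]
        simp
      rw [e, sum_insert_append hz hn hxa a (by omega) (by simp [hj])]
      refine ((sum_pairs_letter hz (fun s t => coef (walk n (m + 1) a
        (List.replicate p 1 ++ List.replicate j 2 ++ s :: t ::
          (List.replicate k 2 ++ List.replicate r z))) x)).2.1).trans ?_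
      rw [coef_eq_coord hz hn hx a (p := p + 2) (q := j + (k + 1) - 1) (r := r),
        inv_double_eq_zero hz e, one_mul]
      · rw [List.perm_iff_count]
        intro b
        simp only [sortedWord, List.count_append, List.count_cons, List.count_replicate, beq_iff_eq]
        split_ifs <;> omega
      · omega
    · subst h4
      obtain ⟨j, hj⟩ : ∃ j, (i : ℕ) = p + q + j := ⟨i - p - q, by omega⟩
      obtain ⟨k, rfl⟩ : ∃ k, r = j + (k + 1) := ⟨r - j - 1, by omega⟩
      have e : sortedWord 4 p q (j + (k + 1)) =
          (List.replicate p 1 ++ List.replicate q 2 ++ List.replicate j 4) ++ 4 ::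
            List.replicate k 4 := by
        rw [sortedWord, List.replicate_add, List.replicate_succ]
        simp
      rw [e, sum_insert_append hz hn hxa a (by omega) (by simp [hj, add_assoc])]
      refine ((sum_pairs_letter hz (fun s t => coef (walk n (m + 1) a
        (List.replicate p 1 ++ List.replicate q 2 ++ List.replicate j 4 ++ s :: t ::
          List.replicate k 4)) x)).2.2).trans ?_
      rw [if_pos rfl, coef_eq_coord hz hn hx a (p := p) (q := q + 2) (r := j + (k + 1) - 1),
        inv_double_eq_zero hz e, one_mul]
      · rw [List.perm_iff_count]
        intro b
        simp only [sortedWord, List.count_append, List.count_cons, List.count_replicate, beq_iff_eq]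
        split_ifs <;> omega
      · omega
    · obtain ⟨j, hj⟩ : ∃ j, (i : ℕ) = p + q + j := ⟨i - p - q, by omega⟩
      obtain ⟨k, rfl⟩ : ∃ k, r = j + (k + 1) := ⟨r - j - 1, by omega⟩
      have e : sortedWord z p q (j + (k + 1)) =
          (List.replicate p 1 ++ List.replicate q 2 ++ List.replicate j z) ++ z ::
            List.replicate k z := by
        rw [sortedWord, List.replicate_add, List.replicate_succ]
        simp
      rw [e, sum_insert_append hz hn hxa a (by omega) (by simp [hj, add_assoc])]
      refine ((sum_pairs_letter hz (fun s t => coef (walk n (m + 1) a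
        (List.replicate p 1 ++ List.replicate q 2 ++ List.replicate j z ++ s :: t ::
          List.replicate k z)) x)).2.2).trans ?_
      rw [if_neg h4]
  rw [coord, coef_boundary (walk_not_irregular a hlen (letters_pos_lt hz hn hlet)),
    Fin.sum_univ_succ, Fin.sum_univ_castSucc]
  simp only [hmid]
  rw [hfirst, Fin.succ_last, hlast]
  simp only [Fin.val_succ, Fin.val_castSucc]
  rw [Fin.sum_univ_eq_sum_range (fun i => (-1 : K) ^ (i + 1) * if i < p then 0 else
    if i < p + q then coord z (p + 2) (q - 1) r a x else
      if z = 4 then coord z p (q + 2) (r - 1) a x else 0) m]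
  subst hm
  rw [Finset.sum_range_add, Finset.sum_range_add]
  have s1 : ∑ i ∈ Finset.range p, ((-1 : K) ^ (i + 1) * if i < p then 0 else
      if i < p + q then coord z (p + 2) (q - 1) r a x else
        if z = 4 then coord z p (q + 2) (r - 1) a x else 0) = 0 :=
    Finset.sum_eq_zero fun i hi => by rw [if_pos (Finset.mem_range.1 hi), mul_zero]
  have s2 : ∑ i ∈ Finset.range q, ((-1 : K) ^ (p + i + 1) * if p + i < p then 0 else
      if p + i < p + q then coord z (p + 2) (q - 1) r a x else
        if z = 4 then coord z p (q + 2) (r - 1) a x else 0) =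
      (if Even q then 0 else (-1) ^ (p + 1) * coord z (p + 2) (q - 1) r a x) := by
    -- All terms of the block agree up to alternating sign, so the sum collapses to a parity
    -- condition on `q`.
    rw [Finset.sum_congr rfl (g := fun i => (-1 : K) ^ i *
      ((-1) ^ (p + 1) * coord z (p + 2) (q - 1) r a x)), ← Finset.sum_mul, neg_one_geom_sum]
    · split_ifs <;> simp
    · intro i hi
      rw [if_neg (by omega), if_pos (by have := Finset.mem_range.1 hi; omega)]
      ring
  have s3 : ∑ i ∈ Finset.range r, ((-1 : K) ^ (p + q + i + 1) * if p + q + i < p then 0 else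
      if p + q + i < p + q then coord z (p + 2) (q - 1) r a x else
        if z = 4 then coord z p (q + 2) (r - 1) a x else 0) =
      (if Even r then 0 else
        if z = 4 then (-1) ^ (p + q + 1) * coord z p (q + 2) (r - 1) a x else 0) := by
    rw [Finset.sum_congr rfl (g := fun i => (-1 : K) ^ i *
      ((-1) ^ (p + q + 1) * if z = 4 then coord z p (q + 2) (r - 1) a x else 0)), ← Finset.sum_mul,
      neg_one_geom_sum]
    · split_ifs <;> simp
    · intro i hi
      rw [if_neg (by omega), if_neg (by omega)]
      ring
  rw [s1, s2, s3]
  simp [hz2.1, hz2.2, not_lt.2 hz2.1.le, not_lt.2 hz2.2.le, pow_add]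
  generalize (if Even q then (0 : K) else _) = A
  generalize (if Even r then (0 : K) else _) = B
  rcases neg_one_pow_eq_or K p with hp | hp <;> rcases neg_one_pow_eq_or K q with hq | hq <;>
    rcases neg_one_pow_eq_or K r with hr | hr <;> rw [hp, hq, hr] <;> ring

end Coordinates

/-! ### Alternating shuffle sums -/

section Generators

variable {K : Type*} [Field K] {n z m : ℕ}

/-- The alternating shuffle sum with letters `c` and coefficients `φ` at the starting vertices. -/
noncomputable def generator [NeZero n] (m : ℕ) (φ : ZMod n → K) (c : Multiset ℕ) :
    Reg K (ZMod n) m :=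
  ∑ w ∈ shuffles m c, (-1 : K) ^ inversions w • ∑ b : ZMod n, φ b • stepPath K n b w

theorem mem_shuffles {c : Multiset ℕ} {w : Fin m → ℕ} :
    w ∈ shuffles m c ↔ (List.ofFn w : Multiset ℕ) = c := by
  simp only [shuffles, Finset.mem_filter, Fintype.mem_piFinset, Multiset.mem_toFinset,
    Fin.univ_val_map, and_iff_right_iff_imp]
  rintro rfl i
  simp

theorem letters_of_mem_shuffles {p q r : ℕ} {w : Fin m → ℕ}
    (hw : w ∈ shuffles m (sortedWord z p q r : Multiset ℕ)) : ∀ s ∈ List.ofFn w, s ∈ letters z :=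
  fun _ hs => letters_sortedWord z p q r _ ((Multiset.coe_eq_coe.1 (mem_shuffles.1 hw)).subset hs)

theorem generator_mem_allowed [NeZero n] (φ : ZMod n → K) (p q r : ℕ) :
    generator m φ (sortedWord z p q r) ∈ allowed K (stepGraph n z) m := by
  refine Submodule.sum_mem _ fun w hw => Submodule.smul_mem _ _ (Submodule.sum_mem _ fun b _ =>
    Submodule.smul_mem _ _ (Submodule.subset_span ⟨_, ?_, stepPath_eq K b w⟩))
  exact walk_isAllowed b (by simp) (letters_of_mem_shuffles hw)

theorem coef_generator [NeZero n] (hz : z = 4 ∨ z = 5) (hn : 10 < n) (φ : ZMod n → K) (p q r : ℕ)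
    (a : ZMod n) {l : List ℕ} (hl : l.length = m) (hll : ∀ s ∈ l, s ∈ letters z) :
    coef (walk n m a l) (generator m φ (sortedWord z p q r)) =
      if l.Perm (sortedWord z p q r) then (-1) ^ inv l * φ a else 0 := by
  classical
  subst hl
  have hstep : ∀ w ∈ shuffles l.length (sortedWord z p q r : Multiset ℕ), ∀ b : ZMod n,
      coef (walk n l.length a l) (stepPath K n b w) = if l.get = w then if a = b then 1 else 0 else 0 := by
    intro w hw b
    have hwl := letters_of_mem_shuffles hw
    rw [stepPath_eq, coef_elem, ← ite_and]
    refine if_congr ⟨fun h => ?_, fun h => ?_⟩ rfl rfl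
    · obtain ⟨rfl, h2⟩ := walk_injective (by simp) rfl (letters_lt hz hn hwl)
        (letters_lt hz hn hll) h.2
      refine ⟨List.ofFn_injective ?_, rfl⟩
      rw [List.ofFn_get, h2]
    · obtain ⟨rfl, rfl⟩ := h
      refine ⟨walk_not_irregular _ rfl (letters_pos_lt hz hn hll), ?_⟩
      rw [List.ofFn_get]
  have hmem : l.get ∈ shuffles l.length (sortedWord z p q r : Multiset ℕ) ↔
      l.Perm (sortedWord z p q r) := by
    rw [mem_shuffles, List.ofFn_get, Multiset.coe_eq_coe]
  rw [generator, map_sum]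
  by_cases hp : l.Perm (sortedWord z p q r)
  · rw [if_pos hp, Finset.sum_eq_single_of_mem _ (hmem.2 hp)]
    · rw [inversions_eq_inv, List.ofFn_get]
      simp [hstep _ (hmem.2 hp)]
    · intro w hw hne
      simp [hstep w hw, hne.symm]
  · rw [if_neg hp]
    refine Finset.sum_eq_zero fun w hw => ?_
    have hne : l.get ≠ w := fun h => hp (hmem.1 (h ▸ hw))
    simp [hstep w hw, hne]

theorem coord_generator [NeZero n] (hz : z = 4 ∨ z = 5) (hn : 10 < n) (φ : ZMod n → K)
    {p q r p' q' r' : ℕ} (hm : p' + q' + r' = m) (a : ZMod n) :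
    coord z p' q' r' a (generator m φ (sortedWord z p q r)) =
      if (p', q', r') = (p, q, r) then φ a else 0 := by
  rw [coord, coef_generator hz hn φ p q r a (by rw [length_sortedWord, hm])
    (letters_sortedWord z _ _ _), inv_sortedWord hz, pow_zero, one_mul]
  exact if_congr (Multiset.coe_eq_coe.symm.trans (sortedWord_coe_inj hz)) rfl rfl

/-- Swapping distinct neighbours changes the inversion sign. Equal neighbours with a forbidden sum
do not occur in an admissible multiset. -/
theorem generator_mem_Omega [CharZero K] [NeZero n] (hz : z = 4 ∨ z = 5) (hn : 10 < n)
    (φ : ZMod n → K) {p q r : ℕ} (hadm : IsAdmissible z q r) :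
    generator m φ (sortedWord z p q r) ∈ Omega K (stepGraph n z) m := by
  rw [mem_Omega_iff hz hn (generator_mem_allowed φ p q r)]
  intro a l₁ l₂ s t h1 h2 hs ht hst hm
  have hlet : ∀ s t, s ∈ letters z → t ∈ letters z → ∀ u ∈ l₁ ++ s :: t :: l₂, u ∈ letters z := by
    intro s t hs ht u hu
    simp only [List.mem_append, List.mem_cons] at hu
    rcases hu with hu | rfl | rfl | hu
    exacts [h1 u hu, hs, ht, h2 u hu]
  simp only
  rw [coef_generator hz hn φ p q r a (by simp; omega) (hlet s t hs ht),
    coef_generator hz hn φ p q r a (by simp; omega) (hlet t s ht hs)]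
  have hperm : (l₁ ++ s :: t :: l₂).Perm (l₁ ++ t :: s :: l₂) :=
    List.Perm.append_left l₁ (List.Perm.swap t s l₂)
  by_cases hne : s = t
  · subst hne
    rw [if_neg, add_zero]
    intro hp
    -- The word would contain `s` at least twice, against admissibility.
    have hc := hp.count_eq s
    obtain ⟨c1, c2, c3⟩ := count_sortedWord hz p q r
    simp only [letters, Finset.mem_insert, Finset.mem_singleton] at hs hst
    simp only [List.count_append, List.count_cons_self] at hc
    obtain ⟨hr, hq⟩ := hadm
    rcases hs with rfl | rfl | rfl
    · omega
    · have := hq (by omega)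
      omega
    · omega
  · rw [neg_one_pow_inv_swap hne, if_congr (hperm.congr_left _) rfl rfl]
    split_ifs <;> simp

end Generators

/-! ### The shift and its eigenvectors -/

section Shift

variable {K : Type*} [Field K] {n z m : ℕ}

theorem shift_elem (v : Fin (m + 1) → ZMod n) :
    shift K n m ((irregular K (ZMod n) m).mkQ (elem K v)) =
      (irregular K (ZMod n) m).mkQ (elem K fun i => v i + 1) := by
  simp [shift, chainShift]

theorem coef_walk_shift (a : ZMod n) (l : List ℕ) (x : Reg K (ZMod n) m) :
    coef (walk n m a l) (shift K n m x) = coef (walk n m (a - 1) l) x := by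
  classical
  have key : coef (walk n m a l) ∘ₗ shift K n m = coef (K := K) (walk n m (a - 1) l) := by
    refine reg_hom_ext fun w => ?_
    rw [LinearMap.comp_apply, shift_elem, coef_elem, coef_elem]
    have hw : ∀ i, walk n m a l i = walk n m (a - 1) l i + 1 := fun i => by
      simp only [walk]
      ring
    refine if_congr (and_congr (not_congr ?_) ?_) rfl rfl
    · simp [IsIrregular, hw]
    · simp [funext_iff, hw]
  exact LinearMap.congr_fun key x

theorem coord_sub_one {lam : K} {x : Reg K (ZMod n) m}
    (hx : x ∈ Module.End.eigenspace (shift K n m) lam) (p q r : ℕ) (a : ZMod n) :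
    coord z p q r (a - 1) x = lam * coord z p q r a x := by
  rw [coord, ← coef_walk_shift, Module.End.mem_eigenspace_iff.1 hx, map_smul, smul_eq_mul, coord]

/-- On an eigenvector the coefficients at all starting vertices follow from the one at 0. This is
also where the powers of the variable in the symbol come from. -/
theorem coord_sub {lam : K} {x : Reg K (ZMod n) m}
    (hx : x ∈ Module.End.eigenspace (shift K n m) lam) (p q r : ℕ) (a : ZMod n) (s : ℕ) :
    coord z p q r (a - (s : ZMod n)) x = lam ^ s * coord z p q r a x := by
  induction s with
  | zero => simp
  | succ s ih =>
    rw [Nat.cast_add, Nat.cast_one, ← sub_sub, coord_sub_one hx, ih]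
    ring

/-- `lam ^ n = 1` makes the powers of `lam⁻¹` well defined on `ℤ/n`. -/
theorem inv_pow_val [NeZero n] {lam : K} (hlam : lam ^ n = 1) (k : ℕ) :
    lam⁻¹ ^ (k : ZMod n).val = lam⁻¹ ^ k := by
  rw [ZMod.val_natCast]
  conv_rhs => rw [← Nat.mod_add_div k n, pow_add, pow_mul, inv_pow lam n, hlam]
  simp

theorem alternator_eq_generator [NeZero n] {lam : K} (c : Multiset ℕ) :
    alternator K n lam m c = generator m (fun a => lam⁻¹ ^ a.val) c := by
  refine Finset.sum_congr rfl fun w _ => ?_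
  congr 1
  refine Finset.sum_bij' (fun a _ => (a : ZMod n)) (fun a _ => a.val) ?_ ?_ ?_ ?_ ?_
  · simp
  · intro a _
    exact Finset.mem_range.2 (ZMod.val_lt a)
  · intro a ha
    exact ZMod.val_cast_of_lt (Finset.mem_range.1 ha)
  · simp
  · intro a ha
    simp only [ZMod.val_cast_of_lt (Finset.mem_range.1 ha)]

theorem shift_alternator [NeZero n] {lam : K} (hlam : lam ^ n = 1) (c : Multiset ℕ) :
    alternator K n lam m c ∈ Module.End.eigenspace (shift K n m) lam := by
  have h0 : lam ≠ 0 := fun h => by simp [h, NeZero.ne n] at hlam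
  rw [Module.End.mem_eigenspace_iff, alternator_eq_generator, generator, map_sum, Finset.smul_sum]
  refine Finset.sum_congr rfl fun w _ => ?_
  rw [map_smul, map_sum, smul_comm lam]
  congr 1
  rw [Finset.smul_sum, ← Equiv.sum_comp (Equiv.addRight (1 : ZMod n)) (fun b => lam • _)]
  refine Finset.sum_congr rfl fun b _ => ?_
  rw [map_smul, smul_smul, stepPath_eq, shift_elem, stepPath_eq]
  congr 1
  · have : b + 1 = ((b.val + 1 : ℕ) : ZMod n) := by simp
    simp only [Equiv.coe_addRight]
    rw [this, inv_pow_val hlam, pow_succ, mul_comm lam, mul_assoc,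
      inv_mul_cancel₀ h0, mul_one]
  · congr 2
    funext i
    simp only [walk, Equiv.coe_addRight]
    ring

end Shift

/-! ### Coordinates and bases of Ω and its eigenspaces; the symbol matrix -/

section Equivalences

variable {K : Type*} [Field K] {n z m : ℕ} {ι : Type*}

/-- `e` lists the multiplicities `(p, q, r)` of the admissible multisets of `m` letters. -/
structure IsEnumeration (z m : ℕ) (e : ι → ℕ × ℕ × ℕ) : Prop where
  injective : Function.Injective e
  degree : ∀ i, (e i).1 + (e i).2.1 + (e i).2.2 = m
  admissible : ∀ i, IsAdmissible z (e i).2.1 (e i).2.2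
  exists_eq : ∀ p q r, p + q + r = m → IsAdmissible z q r → ∃ i, e i = (p, q, r)

variable {e : ι → ℕ × ℕ × ℕ}

theorem IsEnumeration.coord_generator [DecidableEq ι] [NeZero n] (he : IsEnumeration z m e) (hz : z = 4 ∨ z = 5)
    (hn : 10 < n) (φ : ZMod n → K) (i j : ι) (a : ZMod n) :
    coord z (e i).1 (e i).2.1 (e i).2.2 a
        (generator m φ (sortedWord z (e j).1 (e j).2.1 (e j).2.2)) = if i = j then φ a else 0 := by
  rw [PathComplex.coord_generator hz hn φ (he.degree i)]
  exact if_congr he.injective.eq_iff rfl rfl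

/-- `Ω_m` in coordinates. -/
noncomputable def omegaEquiv [Fintype ι] [CharZero K] [NeZero n] (he : IsEnumeration z m e)
    (hz : z = 4 ∨ z = 5) (hn : 10 < n) :
    Omega K (stepGraph n z) m ≃ₗ[K] (ι → ZMod n → K) :=
  LinearEquiv.ofBijective
    (LinearMap.pi fun i => LinearMap.pi fun a =>
      coord z (e i).1 (e i).2.1 (e i).2.2 a ∘ₗ (Omega K (stepGraph n z) m).subtype) <| by
    classical
    constructor
    · rw [← LinearMap.ker_eq_bot, LinearMap.ker_eq_bot']
      intro x hx
      refine Subtype.ext (Omega_eq_zero hz hn x.2 fun p q r a hm hadm => ?_)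
      obtain ⟨i, hi⟩ := he.exists_eq p q r hm hadm
      simpa [hi] using congrFun (congrFun hx i) a
    · intro g
      refine ⟨⟨∑ j, generator m (g j) (sortedWord z (e j).1 (e j).2.1 (e j).2.2),
        Submodule.sum_mem _ fun j _ => generator_mem_Omega hz hn _ (he.admissible j)⟩, ?_⟩
      funext i a
      simp [map_sum, he.coord_generator hz hn]

theorem alternator_mem_OmegaEig [CharZero K] [NeZero n]
    (hz : z = 4 ∨ z = 5) (hn : 10 < n) {lam : K} (hlam : lam ^ n = 1) {p q r : ℕ}
    (hadm : IsAdmissible z q r) :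
    alternator K n lam m (sortedWord z p q r) ∈ OmegaEig K n {1, 2, (z : ZMod n)} lam m :=
  ⟨alternator_eq_generator (K := K) (lam := lam) (m := m) (n := n) _ ▸ generator_mem_Omega hz hn _ hadm,
    shift_alternator hlam _⟩

/-- `Ω_m^{(lam)}` in coordinates. -/
noncomputable def eigEquiv [Fintype ι] [CharZero K] [NeZero n] (he : IsEnumeration z m e)
    (hz : z = 4 ∨ z = 5) (hn : 10 < n) {lam : K} (hlam : lam ^ n = 1) :
    OmegaEig K n {1, 2, (z : ZMod n)} lam m ≃ₗ[K] (ι → K) :=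
  LinearEquiv.ofBijective
    (LinearMap.pi fun i => coord z (e i).1 (e i).2.1 (e i).2.2 0 ∘ₗ
      (OmegaEig K n {1, 2, (z : ZMod n)} lam m).subtype) <| by
    classical
    constructor
    · rw [← LinearMap.ker_eq_bot, LinearMap.ker_eq_bot']
      intro x hx
      refine Subtype.ext (Omega_eq_zero hz hn x.2.1 fun p q r a hm hadm => ?_)
      obtain ⟨i, hi⟩ := he.exists_eq p q r hm hadm
      have h := coord_sub (z := z) x.2.2 p q r 0 (-a).val
      rw [ZMod.natCast_val, ZMod.cast_id, zero_sub, neg_neg] at h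
      rw [h, mul_eq_zero]
      right
      simpa [hi] using congrFun hx i
    · intro g
      refine ⟨∑ j, g j • ⟨alternator K n lam m (sortedWord z (e j).1 (e j).2.1 (e j).2.2),
        alternator_mem_OmegaEig hz hn hlam (he.admissible j)⟩, ?_⟩
      funext i
      simp [map_sum, alternator_eq_generator, he.coord_generator hz hn]

theorem eigEquiv_apply [Fintype ι] [CharZero K] [NeZero n] (he : IsEnumeration z m e)
    (hz : z = 4 ∨ z = 5) (hn : 10 < n) {lam : K} (hlam : lam ^ n = 1)
    (x : OmegaEig K n {1, 2, (z : ZMod n)} lam m) (i : ι) :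
    eigEquiv he hz hn hlam x i = coord z (e i).1 (e i).2.1 (e i).2.2 0 (x : Reg K (ZMod n) m) := rfl

/-- The basis of alternating shuffle sums of `Ω_m^{(lam)}`. -/
noncomputable def eigBasis [Fintype ι] [CharZero K] [NeZero n] (he : IsEnumeration z m e)
    (hz : z = 4 ∨ z = 5) (hn : 10 < n) {lam : K} (hlam : lam ^ n = 1) :
    Module.Basis ι K (OmegaEig K n {1, 2, (z : ZMod n)} lam m) :=
  Module.Basis.ofEquivFun (eigEquiv he hz hn hlam)

theorem eigBasis_repr [Fintype ι] [CharZero K] [NeZero n] (he : IsEnumeration z m e)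
    (hz : z = 4 ∨ z = 5) (hn : 10 < n) {lam : K} (hlam : lam ^ n = 1)
    (x : OmegaEig K n {1, 2, (z : ZMod n)} lam m) (i : ι) :
    (eigBasis he hz hn hlam).repr x i =
      coord z (e i).1 (e i).2.1 (e i).2.2 0 (x : Reg K (ZMod n) m) := rfl

theorem eigBasis_apply [Fintype ι] [CharZero K] [NeZero n] (he : IsEnumeration z m e)
    (hz : z = 4 ∨ z = 5) (hn : 10 < n) {lam : K} (hlam : lam ^ n = 1) (i : ι) :
    (eigBasis he hz hn hlam i : Reg K (ZMod n) m) =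
      alternator K n lam m (sortedWord z (e i).1 (e i).2.1 (e i).2.2) := by
  classical
  have h : eigBasis he hz hn hlam i =
      ⟨alternator K n lam m (sortedWord z (e i).1 (e i).2.1 (e i).2.2),
        alternator_mem_OmegaEig hz hn hlam (he.admissible i)⟩ := by
    rw [eigBasis, Module.Basis.coe_ofEquivFun, LinearEquiv.symm_apply_eq]
    funext j
    simp only [eigEquiv_apply, alternator_eq_generator, he.coord_generator hz hn, Pi.single_apply]
    simp
  rw [h]

/-- The entry of the symbol matrix in row `(p, q, r)` and column `c`. -/
noncomputable def symbol (z p q r : ℕ) (c : ℕ × ℕ × ℕ) : ℤ[X] :=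
  (X + (-1) ^ (p + 1)) * (if (p + 1, q, r) = c then 1 else 0) +
  (-1) ^ p * ((X ^ 2 + (-1) ^ (q + 1)) * if (p, q + 1, r) = c then 1 else 0) +
  (-1) ^ (p + q) * ((X ^ z + (-1) ^ (r + 1)) * if (p, q, r + 1) = c then 1 else 0) +
  (if Even q then 0 else (-1) ^ (p + 1) * if (p + 2, q - 1, r) = c then 1 else 0) +
  (if Even r then 0 else
    if z = 4 then (-1) ^ (p + q + 1) * if (p, q + 2, r - 1) = c then 1 else 0 else 0)

/-- Evaluate `coord_boundary` at starting vertex 0 on a basis vector: a coordinate is the indicator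
of its multiset, and moving the start back by `s` multiplies it by `lam ^ s`. -/
theorem toMatrix_dEig {κ : Type*} [Fintype ι] [Fintype κ] [DecidableEq κ] [CharZero K] [NeZero n]
    {e' : κ → ℕ × ℕ × ℕ} (he : IsEnumeration z m e) (he' : IsEnumeration z (m + 1) e')
    (hz : z = 4 ∨ z = 5) (hn : 10 < n) {lam : K} (hlam : lam ^ n = 1) :
    LinearMap.toMatrix (eigBasis he' hz hn hlam) (eigBasis he hz hn hlam)
      (dEig K n {1, 2, (z : ZMod n)} lam m) =
      (Matrix.of fun i j => symbol z (e i).1 (e i).2.1 (e i).2.2 (e' j)).map (aeval lam) := by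
  ext i j
  rw [LinearMap.toMatrix_apply, eigBasis_repr]
  have hx := (eigBasis he' hz hn hlam j).2
  have hb : ∀ p q r, p + q + r = m + 1 → ∀ s : ℕ,
      coord z p q r (0 - (s : ZMod n)) (eigBasis he' hz hn hlam j : Reg K (ZMod n) (m + 1)) =
        lam ^ s * if (p, q, r) = e' j then 1 else 0 := by
    intro p q r hm s
    rw [coord_sub hx.2, eigBasis_apply, alternator_eq_generator, coord_generator hz hn _ hm]
    simp
  have hm := he.degree i
  have h1 := hb ((e i).1 + 1) (e i).2.1 (e i).2.2 (by omega)
  have h2 := hb (e i).1 ((e i).2.1 + 1) (e i).2.2 (by omega)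
  have h3 := hb (e i).1 (e i).2.1 ((e i).2.2 + 1) (by omega)
  have h11 := h1 1
  have h10 := h1 0
  have h22 := h2 2
  have h20 := h2 0
  have h33 := h3 z
  have h30 := h3 0
  have h4 : ¬ Even (e i).2.1 → coord z ((e i).1 + 2) ((e i).2.1 - 1) (e i).2.2 (0 : ZMod n)
      (eigBasis he' hz hn hlam j : Reg K (ZMod n) (m + 1)) =
      if ((e i).1 + 2, (e i).2.1 - 1, (e i).2.2) = e' j then 1 else 0 := fun ho => by
    have := (Nat.not_even_iff_odd.1 ho).pos
    simpa using hb ((e i).1 + 2) ((e i).2.1 - 1) (e i).2.2 (by omega) 0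
  have h5 : ¬ Even (e i).2.2 → coord z (e i).1 ((e i).2.1 + 2) ((e i).2.2 - 1) (0 : ZMod n)
      (eigBasis he' hz hn hlam j : Reg K (ZMod n) (m + 1)) =
      if ((e i).1, (e i).2.1 + 2, (e i).2.2 - 1) = e' j then 1 else 0 := fun ho => by
    have := (Nat.not_even_iff_odd.1 ho).pos
    simpa using hb (e i).1 ((e i).2.1 + 2) ((e i).2.2 - 1) (by omega) 0
  simp only [Nat.cast_zero, sub_zero, pow_zero, one_mul, Nat.cast_one, pow_one,
    Nat.cast_ofNat] at h11 h10 h22 h20 h33 h30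
  refine (coord_boundary hz hn hx.1 hm 0).trans ?_
  rw [h11, h10, h22, h20, h33, h30]
  simp only [Matrix.map_apply, Matrix.of_apply, symbol, map_add, map_mul, map_pow, map_neg, map_one,
    aeval_X, apply_ite (aeval lam), map_zero]
  congr 1
  · congr 1
    · ring
    · split_ifs with h h'
      · rfl
      · rw [h4 h, if_pos h']
      · rw [h4 h, if_neg h']
  · split_ifs with h h' h''
    · rfl
    · rw [h5 h, if_pos h'']
    · rw [h5 h, if_neg h'']
    · rfl

end Equivalences

/-! ### Coordinates that determine a cycle -/

section Kernels

variable {K : Type*} [Field K] {n z m : ℕ} [NeZero n]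

theorem eq_zero_of_sub_one {f : ZMod n → K} (h : ∀ a, f (a - 1) = f a) (h0 : f 0 = 0)
    (a : ZMod n) : f a = 0 := by
  have hk : ∀ k : ℕ, f (k : ZMod n) = 0 := by
    intro k
    induction k with
    | zero => simpa using h0
    | succ k ih => rw [← h]; simpa using ih
  simpa using hk a.val

variable [CharZero K]

/-- Once the 2-steps and `z`-steps are gone, the cycle equation makes the coefficient of the 1-steps
constant on `ℤ/n`. -/
theorem eq_zero_of_boundary_degree_one (hz : z = 4 ∨ z = 5) (hn : 10 < n) {x : Reg K (ZMod n) 1}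
    (hx : x ∈ Omega K (stepGraph n z) 1) (hd : boundary K (ZMod n) 0 x = 0)
    (h2 : ∀ a, coord z 0 1 0 a x = 0) (h3 : ∀ a, coord z 0 0 1 a x = 0)
    (h1 : coord z 1 0 0 (0 : ZMod n) x = 0) : x = 0 := by
  have h : ∀ a, coord z 1 0 0 (a - 1) x = coord z 1 0 0 a x := fun a => by
    have := coord_boundary hz hn hx (p := 0) (q := 0) (r := 0) rfl a
    simp only [hd, map_zero, zero_add, h2, h3] at this
    simp at this
    linear_combination -this
  refine Omega_eq_zero hz hn hx fun p q r a hm _ => ?_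
  rcases (by omega : (p = 1 ∧ q = 0 ∧ r = 0) ∨ (p = 0 ∧ q = 1 ∧ r = 0) ∨ (p = 0 ∧ q = 0 ∧ r = 1))
    with ⟨rfl, rfl, rfl⟩ | ⟨rfl, rfl, rfl⟩ | ⟨rfl, rfl, rfl⟩
  · exact eq_zero_of_sub_one (f := fun a => coord z 1 0 0 a x) h h1 a
  · exact h2 a
  · exact h3 a

/-- In the equation at a word with an odd number of 2s, the word with one 2 split into 1 + 1 appears
with coefficient ±1. All other terms have an odd number of 2s or fewer 1s, or carry no 4 or two 4s,
so induction on the number of 1s applies, first to words with a 4 and then to words without. -/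
theorem eq_zero_of_boundary_four (hn : 10 < n) (hm : 1 ≤ m) {x : Reg K (ZMod n) (m + 1)}
    (hx : x ∈ Omega K (stepGraph n 4) (m + 1)) (hd : boundary K (ZMod n) m x = 0)
    (hU : ∀ p q a, p + q = m + 1 → Odd q → coord 4 p q 0 a x = 0)
    (hV : ∀ p q a, p + q = m → Odd q ∨ p ≤ 1 → coord 4 p q 1 a x = 0) : x = 0 := by
  have hz : (4 : ℕ) = 4 ∨ (4 : ℕ) = 5 := Or.inl rfl
  have hV' : ∀ p q a, p + q = m → coord 4 p q 1 a x = 0 := by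
    intro p
    induction p using Nat.strong_induction_on with
    | _ p ih =>
      intro q a hpq
      by_cases hc : Odd q ∨ p ≤ 1
      · exact hV p q a hpq hc
      obtain ⟨hq, hp⟩ := not_or.1 hc
      obtain ⟨p, rfl⟩ := Nat.exists_eq_add_of_le' (not_le.1 hp)
      have hq1 : Odd (q + 1) := (Nat.not_odd_iff_even.1 hq).add_one
      have hE := coord_boundary hz hn hx (p := p) (q := q + 1) (r := 1) (by omega) a
      simp only [hd, map_zero, fun b => hV (p + 1) (q + 1) b (by omega) (Or.inl hq1),
        fun b => ih p (by omega) (q + 1 + 1) b (by omega),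
        fun b => coord_eq_zero hz hn hx b (p := p) (q := q + 1) (r := 1 + 1)
          (fun h => by simp [IsAdmissible] at h) (by omega),
        Nat.not_even_iff_odd.2 hq1, Nat.not_even_one, if_true, if_false, Nat.add_sub_cancel,
        Nat.sub_self,
        fun b => hU p (q + 1 + 2) b (by omega) (hq1.add_even even_two)] at hE
      simpa using hE
  refine Omega_eq_zero hz hn hx fun p q r a hpqr hadm => ?_
  rcases (by have := hadm.1; omega : r = 1 ∨ r = 0) with rfl | rfl
  · exact hV' p q a (by omega)
  · revert q a
    induction p using Nat.strong_induction_on with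
    | _ p ih =>
      intro q a hpq _
      by_cases hq : Odd q
      · exact hU p q a hpq hq
      by_cases hp : p ≤ 1
      · obtain ⟨k, hk⟩ := Nat.not_odd_iff_even.1 hq
        -- `1 ≤ m` and `p ≤ 1` force the even number `q` to be at least 2. With too few 1s to undo 2
        -- = 1 + 1, the splitting 4 = 2 + 2 takes over, at the word with `q - 2` letters 2 and one
        -- 4.
        obtain ⟨q, rfl⟩ : ∃ q', q = q' + 2 := ⟨q - 2, by omega⟩
        have hq0 : Even q := ⟨k - 1, by omega⟩
        have hE := coord_boundary hz hn hx (p := p) (q := q) (r := 1) (by omega) a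
        simp only [hd, map_zero, fun b => hV' (p + 1) q b (by omega),
          fun b => hV' p (q + 1) b (by omega),
          fun b => coord_eq_zero hz hn hx b (p := p) (q := q) (r := 1 + 1)
            (fun h => by simp [IsAdmissible] at h) (by omega),
          hq0, Nat.not_even_one, if_true, if_false, Nat.sub_self] at hE
        simpa using hE
      · obtain ⟨p, rfl⟩ := Nat.exists_eq_add_of_le' (not_le.1 hp)
        have hq1 : Odd (q + 1) := (Nat.not_odd_iff_even.1 hq).add_one
        have hE := coord_boundary hz hn hx (p := p) (q := q + 1) (r := 0) (by omega) a
        simp only [hd, map_zero, fun b => hU (p + 1) (q + 1) b (by omega) hq1,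
          fun b => ih p (by omega) (q + 1 + 1) b (by omega) ⟨by simp, by simp⟩,
          fun b => hV' p (q + 1) b (by omega), zero_add,
          Nat.not_even_iff_odd.2 hq1, Even.zero, if_true, if_false, Nat.add_sub_cancel] at hE
        simpa using hE

/-- Coordinates in degree `m + 1` that determine a cycle for the steps `1, 2, 4`. -/
def freeIndex (m k : ℕ) : ℕ × ℕ × ℕ :=
  if Odd k then (m + 1 - k, k, 0) else
    if k + 1 ≤ m then (m - 1 - k, k + 1, 1) else (m - 2 * (m / 2), 2 * (m / 2), 1)

/-- The `m + 2` indices cover the hypotheses of `eq_zero_of_boundary_four`: odd `k` gives an odd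
number of 2s without 4, even `k < m` an odd number of 2s with a 4, and the one even `k` in {m, m +
1} the remaining word with a 4, an even number of 2s and at most one 1. -/
theorem eq_zero_of_freeIndex (hn : 10 < n) (hm : 1 ≤ m) {x : Reg K (ZMod n) (m + 1)}
    (hx : x ∈ Omega K (stepGraph n 4) (m + 1)) (hd : boundary K (ZMod n) m x = 0)
    (h : ∀ k < m + 2, ∀ a, coord 4 (freeIndex m k).1 (freeIndex m k).2.1 (freeIndex m k).2.2 a x = 0) :
    x = 0 := by
  refine eq_zero_of_boundary_four hn hm hx hd (fun p q a hpq hq => ?_) fun p q a hpq hc => ?_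
  · have := h q (by omega) a
    rw [freeIndex, if_pos hq] at this
    rwa [(by omega : p = m + 1 - q)]
  · by_cases hq : Odd q
    · obtain ⟨j, rfl⟩ := hq
      have := h (2 * j) (by omega) a
      rw [freeIndex, if_neg (Nat.not_odd_iff_even.2 (even_two_mul j)), if_pos (by omega)] at this
      rwa [(by omega : p = m - 1 - 2 * j)]
    · have hp := hc.resolve_left hq
      obtain ⟨j, rfl⟩ := Nat.not_odd_iff_even.1 hq
      -- `2 * ((m + 1) / 2)` is the even one of `m` and `m + 1`.
      have := h (2 * ((m + 1) / 2)) (by omega) a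
      rw [freeIndex, if_neg (Nat.not_odd_iff_even.2 (even_two_mul _)), if_neg (by omega)] at this
      have e1 : j + j = 2 * (m / 2) := by omega
      rw [e1] at hpq ⊢
      rwa [(by omega : p = m - 2 * (m / 2))]

/-- The equations at `1^{m+1} 2` and `1^m 2 5` express the coefficients without a 2 through those
with a 2, since a second 2 or 5 is inadmissible. -/
theorem eq_zero_of_boundary_five (hn : 10 < n) {x : Reg K (ZMod n) (m + 3)}
    (hx : x ∈ Omega K (stepGraph n 5) (m + 3)) (hd : boundary K (ZMod n) (m + 2) x = 0)
    (hB : ∀ a, coord 5 (m + 2) 1 0 a x = 0) (hD : ∀ a, coord 5 (m + 1) 1 1 a x = 0) : x = 0 := by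
  have hz : (5 : ℕ) = 4 ∨ (5 : ℕ) = 5 := Or.inr rfl
  have hA : ∀ a, coord 5 (m + 3) 0 0 a x = 0 := fun a => by
    have hE := coord_boundary hz hn hx (p := m + 1) (q := 1) (r := 0) (by omega) a
    simp only [hd, map_zero, hB, hD, zero_add,
      fun b => coord_eq_zero hz hn hx b (p := m + 1) (q := 1 + 1) (r := 0)
        (fun h => by simp [IsAdmissible] at h) (by omega)] at hE
    simpa using hE
  have hC : ∀ a, coord 5 (m + 2) 0 1 a x = 0 := fun a => by
    have hE := coord_boundary hz hn hx (p := m) (q := 1) (r := 1) (by omega) a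
    simp only [hd, map_zero, hD,
      fun b => coord_eq_zero hz hn hx b (p := m) (q := 1 + 1) (r := 1)
        (fun h => by simp [IsAdmissible] at h) (by omega),
      fun b => coord_eq_zero hz hn hx b (p := m) (q := 1) (r := 1 + 1)
        (fun h => by simp [IsAdmissible] at h) (by omega)] at hE
    simpa using hE
  refine Omega_eq_zero hz hn hx fun p q r a hm hadm => ?_
  obtain ⟨hr, hq⟩ := hadm
  have hq := hq rfl
  rcases (by omega : (q = 0 ∧ r = 0) ∨ (q = 1 ∧ r = 0) ∨ (q = 0 ∧ r = 1) ∨ (q = 1 ∧ r = 1))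
    with ⟨rfl, rfl⟩ | ⟨rfl, rfl⟩ | ⟨rfl, rfl⟩ | ⟨rfl, rfl⟩
  · rw [(by omega : p = m + 3)]; exact hA a
  · rw [(by omega : p = m + 2)]; exact hB a
  · rw [(by omega : p = m + 2)]; exact hC a
  · rw [(by omega : p = m + 1)]; exact hD a

/-- The equation at `1^m 2 5` has no analogue this low. The one at the single step 5 only makes the
coefficient of `1 5` constant, which costs one extra parameter. -/
theorem eq_zero_of_boundary_five_degree_two (hn : 10 < n) {x : Reg K (ZMod n) 2}
    (hx : x ∈ Omega K (stepGraph n 5) 2) (hd : boundary K (ZMod n) 1 x = 0)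
    (hB : ∀ a, coord 5 1 1 0 a x = 0) (hD : ∀ a, coord 5 0 1 1 a x = 0)
    (hC : coord 5 1 0 1 (0 : ZMod n) x = 0) : x = 0 := by
  have hz : (5 : ℕ) = 4 ∨ (5 : ℕ) = 5 := Or.inr rfl
  have hA : ∀ a, coord 5 2 0 0 a x = 0 := fun a => by
    have hE := coord_boundary hz hn hx (p := 0) (q := 1) (r := 0) (by omega) a
    simp only [hd, map_zero, hB, hD, zero_add,
      fun b => coord_eq_zero hz hn hx b (p := 0) (q := 1 + 1) (r := 0)
        (fun h => by simp [IsAdmissible] at h) (by omega)] at hE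
    simpa using hE
  have hC' : ∀ a, coord 5 1 0 1 (a - 1) x = coord 5 1 0 1 a x := fun a => by
    have hE := coord_boundary hz hn hx (p := 0) (q := 0) (r := 1) (by omega) a
    simp only [hd, map_zero, hD, zero_add,
      fun b => coord_eq_zero hz hn hx b (p := 0) (q := 0) (r := 1 + 1)
        (fun h => by simp [IsAdmissible] at h) (by omega)] at hE
    simp at hE
    linear_combination -hE
  refine Omega_eq_zero hz hn hx fun p q r a hm hadm => ?_
  obtain ⟨hr, hq⟩ := hadm
  have hq := hq rfl
  rcases (by omega : (q = 0 ∧ r = 0) ∨ (q = 1 ∧ r = 0) ∨ (q = 0 ∧ r = 1) ∨ (q = 1 ∧ r = 1))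
    with ⟨rfl, rfl⟩ | ⟨rfl, rfl⟩ | ⟨rfl, rfl⟩ | ⟨rfl, rfl⟩
  · rw [(by omega : p = 2)]; exact hA a
  · rw [(by omega : p = 1)]; exact hB a
  · rw [(by omega : p = 1)]; exact eq_zero_of_sub_one (f := fun a => coord 5 1 0 1 a x) hC' hC a
  · rw [(by omega : p = 0)]; exact hD a

end Kernels

/-! ### Rank inequalities -/

section LinearAlgebra

variable {K A B C : Type*} [Field K] [AddCommGroup A] [AddCommGroup B] [AddCommGroup C]
  [Module K A] [Module K B] [Module K C]

/-- The map `c` is injective on the kernel of `f`, so the kernel is no larger than `C`. -/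
theorem finrank_le_rank_add [FiniteDimensional K A] [FiniteDimensional K C] (f : A →ₗ[K] B)
    (c : A →ₗ[K] C) (h : ∀ x, f x = 0 → c x = 0 → x = 0) :
    Module.finrank K A ≤ Module.finrank K (LinearMap.range f) + Module.finrank K C := by
  rw [← f.finrank_range_add_finrank_ker]
  refine Nat.add_le_add_left (LinearMap.finrank_le_finrank_of_injective
    (f := c.domRestrict (LinearMap.ker f)) ?_) _
  rw [← LinearMap.ker_eq_bot, LinearMap.ker_eq_bot']
  exact fun x hx => Subtype.ext (h x x.2 hx)

theorem rank_add_rank_le [FiniteDimensional K B] (f : A →ₗ[K] B) (g : B →ₗ[K] C)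
    (h : ∀ x, g (f x) = 0) : Module.finrank K (LinearMap.range f) +
      Module.finrank K (LinearMap.range g) ≤ Module.finrank K B := by
  rw [← g.finrank_range_add_finrank_ker, add_comm]
  refine Nat.add_le_add_left (Submodule.finrank_mono ?_) _
  rintro _ ⟨x, rfl⟩
  exact h x

end LinearAlgebra

/-! ### Betti numbers from dimensions and ranks -/

section HomologyRank

variable {K V : Type*} [Field K] (G : Digraph V) (m : ℕ)

theorem dOmega_dOmega (x : Omega K G (m + 2)) : dOmega K G m (dOmega K G (m + 1) x) = 0 :=
  Subtype.ext (boundary_boundary K V m x)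

theorem finrank_homology_zero [Module.Finite K (Omega K G 0)] :
    Module.finrank K (Homology K G 0) + Module.finrank K (LinearMap.range (dOmega K G 0)) =
      Module.finrank K (Omega K G 0) := by
  have e := (Submodule.submoduleOfEquivOfLe
    (le_top : LinearMap.range (dOmega K G 0) ≤ cycles K G 0)).finrank_eq
  rw [← e]
  exact (Submodule.finrank_quotient_add_finrank _).trans (finrank_top K _)

theorem finrank_homology_succ [Module.Finite K (Omega K G (m + 1))] :
    Module.finrank K (Homology K G (m + 1)) +
      Module.finrank K (LinearMap.range (dOmega K G (m + 1))) +
        Module.finrank K (LinearMap.range (dOmega K G m)) = Module.finrank K (Omega K G (m + 1)) := by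
  have hle : LinearMap.range (dOmega K G (m + 1)) ≤ cycles K G (m + 1) := by
    rintro _ ⟨x, rfl⟩
    exact dOmega_dOmega G m x
  have e := (Submodule.submoduleOfEquivOfLe hle).finrank_eq
  rw [← e, add_comm, ← (dOmega K G m).finrank_range_add_finrank_ker]
  exact congrArg _ (Submodule.finrank_quotient_add_finrank _)

end HomologyRank

/-! ### Admissible multisets in each degree -/

section Enumerations

variable {z m : ℕ}

/-- The multiplicities of the letters `1, 2, 4` in `letters124`. -/
def multiplicities124 (m : ℕ) : Fin (m + 1) ⊕ Fin m → ℕ × ℕ × ℕ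
  | .inl k => (m - k, k, 0)
  | .inr k => (m - 1 - k, k, 1)

/-- The multiplicities of the letters `1, 2, 5` in `letters125`, in degree `m + 2`. -/
def multiplicities125 (m : ℕ) : Fin 4 → ℕ × ℕ × ℕ :=
  ![(m + 2, 0, 0), (m + 1, 1, 0), (m + 1, 0, 1), (m, 1, 1)]

/-- In degrees 0 and 1 nothing can repeat, so the same list also serves `z = 5`. -/
theorem isEnumeration124 (h : z = 4 ∨ m ≤ 1) : IsEnumeration z m (multiplicities124 m) where
  injective := by
    rintro (i | i) (j | j) hij <;> simp [multiplicities124] at hij <;> congr 1 <;> ext <;> omega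
  degree := by
    rintro (i | i) <;> simp only [multiplicities124] <;> omega
  admissible := by
    rintro (i | i) <;> simp only [multiplicities124, IsAdmissible] <;> omega
  exists_eq := by
    rintro p q r hm ⟨hr, -⟩
    rcases (by omega : r = 0 ∨ r = 1) with rfl | rfl
    · exact ⟨.inl ⟨q, by omega⟩, by simp [multiplicities124]; omega⟩
    · exact ⟨.inr ⟨q, by omega⟩, by simp [multiplicities124]; omega⟩

theorem isEnumeration125 (m : ℕ) : IsEnumeration 5 (m + 2) (multiplicities125 m) where
  injective := by
    intro i j hij
    fin_cases i <;> fin_cases j <;> simp [multiplicities125] at hij ⊢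
  degree := by
    intro i
    fin_cases i <;> simp [multiplicities125]
  admissible := by
    intro i
    fin_cases i <;> simp [multiplicities125, IsAdmissible]
  exists_eq := by
    rintro p q r hm ⟨hr, hq⟩
    have hq := hq rfl
    rcases (by omega : (q = 0 ∧ r = 0) ∨ (q = 1 ∧ r = 0) ∨ (q = 0 ∧ r = 1) ∨ (q = 1 ∧ r = 1))
      with ⟨rfl, rfl⟩ | ⟨rfl, rfl⟩ | ⟨rfl, rfl⟩ | ⟨rfl, rfl⟩
    · exact ⟨0, by simp [multiplicities125]; omega⟩
    · exact ⟨1, by simp [multiplicities125]; omega⟩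
    · exact ⟨2, by simp [multiplicities125]; omega⟩
    · exact ⟨3, by simp [multiplicities125]; omega⟩

theorem sortedWord_multiplicities124 (m : ℕ) (i : Fin (m + 1) ⊕ Fin m) :
    (sortedWord 4 (multiplicities124 m i).1 (multiplicities124 m i).2.1
      (multiplicities124 m i).2.2 : Multiset ℕ) = letters124 m i := by
  rcases i with i | i <;>
    simp only [sortedWord, multiplicities124, letters124, ← Multiset.coe_add, Multiset.coe_replicate,
      Multiset.replicate_zero, Multiset.replicate_one, add_zero, add_assoc]

theorem sortedWord_multiplicities125 (m : ℕ) (i : Fin 4) :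
    (sortedWord 5 (multiplicities125 m i).1 (multiplicities125 m i).2.1
      (multiplicities125 m i).2.2 : Multiset ℕ) = letters125 (m + 2) i := by
  simp only [sortedWord, ← Multiset.coe_add, Multiset.coe_replicate]
  fin_cases i <;>
    simp [multiplicities125, letters125, -Multiset.replicate_succ, Multiset.replicate_one,
      ← Multiset.singleton_add]

end Enumerations

/-! ### Ranks of the differentials on Ω -/

section Ranks

variable {K : Type*} [Field K] [CharZero K] {n z m : ℕ} [NeZero n]

theorem finite_finrank_Omega {ι : Type*} [Fintype ι] {e : ι → ℕ × ℕ × ℕ}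
    (he : IsEnumeration z m e) (hz : z = 4 ∨ z = 5) (hn : 10 < n) :
    Module.Finite K (Omega K (stepGraph n z) m) ∧
      Module.finrank K (Omega K (stepGraph n z) m) = Fintype.card ι * n := by
  refine ⟨Module.Finite.equiv (omegaEquiv he hz hn).symm, ?_⟩
  rw [(omegaEquiv (K := K) he hz hn).finrank_eq]
  simp [Module.finrank_pi_fintype]

omit [CharZero K] [NeZero n] in
theorem eq_zero_of_dOmega {x : Omega K (stepGraph n z) (m + 1)}
    (h : dOmega K (stepGraph n z) m x = 0) : boundary K (ZMod n) m (x : Reg K (ZMod n) (m + 1)) = 0 :=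
  congrArg Subtype.val h

/-- The coefficients of the paths with steps `1^p 2^q z^r`, on `Ω_m`. -/
noncomputable def coordVec (K : Type*) [Field K] (n z m p q r : ℕ) :
    Omega K (stepGraph n z) m →ₗ[K] (ZMod n → K) :=
  LinearMap.pi fun a => coord z p q r a ∘ₗ (Omega K (stepGraph n z) m).subtype

omit [CharZero K] in
theorem sum_sub_right (f : ZMod n → K) (s : ZMod n) : ∑ a, f (a - s) = ∑ a, f a :=
  Equiv.sum_comp (Equiv.subRight s) f

/-- Coefficients of a boundary sum to zero, while the sum of all vertices has total `n ≠ 0`.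
Conversely a 1-cycle depends on `2n + 1` of its `3n` parameters. -/
theorem rank_zero (hz : z = 4 ∨ z = 5) (hn : 10 < n) :
    Module.finrank K (LinearMap.range (dOmega K (stepGraph n z) 0)) + 1 = n := by
  obtain ⟨hf0, h0⟩ := finite_finrank_Omega (K := K)
    (isEnumeration124 (z := z) (m := 0) (Or.inr (by norm_num))) hz hn
  obtain ⟨hf1, h1⟩ := finite_finrank_Omega (K := K)
    (isEnumeration124 (z := z) (m := 1) (Or.inr le_rfl)) hz hn
  simp at h0 h1
  refine le_antisymm ?_ ?_
  · refine Nat.succ_le_of_lt ((Submodule.finrank_lt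
      fun htop => ?_).trans_eq h0)
    have hmem : (⟨generator 0 (fun _ => 1) (sortedWord z 0 0 0),
        generator_mem_Omega hz hn _ (by simp [IsAdmissible])⟩ : Omega K (stepGraph n z) 0) ∈
          LinearMap.range (dOmega K (stepGraph n z) 0) := htop ▸ Submodule.mem_top
    obtain ⟨y, hy⟩ := hmem
    have hy' : boundary K (ZMod n) 0 (y : Reg K (ZMod n) 1) =
      generator 0 (fun _ => 1) (sortedWord z 0 0 0) := congrArg Subtype.val hy
    have hs : ∑ a : ZMod n, coord z 0 0 0 a (boundary K (ZMod n) 0 (y : Reg K (ZMod n) 1)) = 0 := by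
      simp only [coord_boundary hz hn y.2 (p := 0) (q := 0) (r := 0) rfl, Finset.sum_add_distrib,
        ← Finset.mul_sum, zero_add]
      rw [sum_sub_right (fun a => coord z 1 0 0 a (y : Reg K _ 1)) (1 : ZMod n),
        sum_sub_right (fun a => coord z 0 1 0 a (y : Reg K _ 1)) (2 : ZMod n),
        sum_sub_right (fun a => coord z 0 0 1 a (y : Reg K _ 1)) (z : ZMod n)]
      simp
    rw [hy'] at hs
    simp [coord_generator hz hn _ (show 0 + 0 + 0 = 0 from rfl), NeZero.ne n] at hs
  · have := finrank_le_rank_add (dOmega K (stepGraph n z) 0)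
      ((coordVec K n z 1 0 1 0).prod ((coordVec K n z 1 0 0 1).prod
        (LinearMap.proj 0 ∘ₗ coordVec K n z 1 1 0 0))) fun x hd hc => by
      rw [← LinearMap.mem_ker, LinearMap.ker_prod, LinearMap.ker_prod] at hc
      exact Subtype.ext (eq_zero_of_boundary_degree_one hz hn x.2 (eq_zero_of_dOmega hd)
        (congrFun (LinearMap.mem_ker.1 hc.1)) (congrFun (LinearMap.mem_ker.1 hc.2.1)) (LinearMap.mem_ker.1 hc.2.2))
    simp [h1] at this
    omega

/-- Of `(2m + 3)n` parameters at most `(m + 2)n` survive on the kernel. -/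
theorem rank_four_ge (hn : 10 < n) (hm : 1 ≤ m) :
    (m + 1) * n ≤ Module.finrank K (LinearMap.range (dOmega K (stepGraph n 4) m)) := by
  obtain ⟨hf, h⟩ := finite_finrank_Omega (K := K)
    (isEnumeration124 (z := 4) (m := m + 1) (Or.inl rfl)) (Or.inl rfl) hn
  have := finrank_le_rank_add (dOmega K (stepGraph n 4) m)
    (LinearMap.pi fun k : Fin (m + 2) => coordVec K n 4 (m + 1) (freeIndex m k).1
      (freeIndex m k).2.1 (freeIndex m k).2.2) fun x hd hc =>
    Subtype.ext (eq_zero_of_freeIndex hn hm x.2 (eq_zero_of_dOmega hd) fun k hk a =>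
      congrFun (congrFun hc ⟨k, hk⟩) a)
  simp [h, Module.finrank_pi_fintype] at this
  nlinarith

theorem rank_five_ge (hn : 10 < n) :
    2 * n ≤ Module.finrank K (LinearMap.range (dOmega K (stepGraph n 5) (m + 2))) := by
  obtain ⟨hf, h⟩ := finite_finrank_Omega (K := K) (isEnumeration125 (m + 1)) (Or.inr rfl) hn
  have := finrank_le_rank_add (dOmega K (stepGraph n 5) (m + 2))
    ((coordVec K n 5 (m + 3) (m + 2) 1 0).prod (coordVec K n 5 (m + 3) (m + 1) 1 1))
    fun x hd hc => by
      rw [← LinearMap.mem_ker, LinearMap.ker_prod] at hc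
      exact Subtype.ext (eq_zero_of_boundary_five hn x.2 (eq_zero_of_dOmega hd)
        (congrFun (LinearMap.mem_ker.1 hc.1)) (congrFun (LinearMap.mem_ker.1 hc.2)))
  erw [h] at this
  simp at this
  omega

theorem rank_five_one_ge (hn : 10 < n) :
    2 * n ≤ Module.finrank K (LinearMap.range (dOmega K (stepGraph n 5) 1)) + 1 := by
  obtain ⟨hf, h⟩ := finite_finrank_Omega (K := K) (isEnumeration125 0) (Or.inr rfl) hn
  have := finrank_le_rank_add (dOmega K (stepGraph n 5) 1)
    ((coordVec K n 5 2 1 1 0).prod ((coordVec K n 5 2 0 1 1).prod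
      (LinearMap.proj 0 ∘ₗ coordVec K n 5 2 1 0 1))) fun x hd hc => by
      rw [← LinearMap.mem_ker, LinearMap.ker_prod, LinearMap.ker_prod] at hc
      exact Subtype.ext (eq_zero_of_boundary_five_degree_two hn x.2 (eq_zero_of_dOmega hd)
        (congrFun (LinearMap.mem_ker.1 hc.1)) (congrFun (LinearMap.mem_ker.1 hc.2.1)) (LinearMap.mem_ker.1 hc.2.2))
  erw [h] at this
  simp at this
  omega

/-- The cycle `∑_a ((a; 1, 5) - (a; 5, 1))` does not bound. -/
theorem rank_five_one_add_two_lt (hn : 10 < n) :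
    Module.finrank K (LinearMap.range (dOmega K (stepGraph n 5) 2)) +
      Module.finrank K (LinearMap.range (dOmega K (stepGraph n 5) 1)) < 4 * n := by
  have hz : (5 : ℕ) = 4 ∨ (5 : ℕ) = 5 := Or.inr rfl
  obtain ⟨hf, h⟩ := finite_finrank_Omega (K := K) (isEnumeration125 0) (Or.inr rfl) hn
  have hrk := (dOmega K (stepGraph n 5) 1).finrank_range_add_finrank_ker
  rw [Fintype.card_fin] at h
  erw [h] at hrk
  rw [← hrk, add_comm]
  refine Nat.add_lt_add_left (Submodule.finrank_lt_finrank_of_lt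
    (lt_of_le_of_ne ?_ fun heq => ?_)) _
  · rintro _ ⟨x, rfl⟩
    exact dOmega_dOmega _ 1 x
  · have hx := generator_mem_Omega (K := K) (z := 5) (n := n) (m := 2) hz hn (fun _ => 1)
      (p := 1) (q := 0) (r := 1) (by simp [IsAdmissible])
    have hmem : (⟨_, hx⟩ : Omega K (stepGraph n 5) 2) ∈
        LinearMap.range (dOmega K (stepGraph n 5) 2) := by
      rw [heq, LinearMap.mem_ker]
      refine Subtype.ext (Omega_eq_zero hz hn (boundary_mem_Omega K _ 1 _ hx)
        fun p q r a hm _ => ?_)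
      rcases (by omega : (p = 1 ∧ q = 0 ∧ r = 0) ∨ (p = 0 ∧ q = 1 ∧ r = 0) ∨
        (p = 0 ∧ q = 0 ∧ r = 1)) with ⟨rfl, rfl, rfl⟩ | ⟨rfl, rfl, rfl⟩ | ⟨rfl, rfl, rfl⟩ <;>
      · refine (coord_boundary hz hn hx (by norm_num) a).trans ?_
        simp [coord_generator hz hn]
    obtain ⟨y, hy⟩ := hmem
    have hy' : boundary K (ZMod n) 2 (y : Reg K (ZMod n) 3) =
      generator 2 (fun _ => 1) (sortedWord 5 1 0 1) := congrArg Subtype.val hy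
    -- This functional kills all boundaries: summed over `a`, adding a 1 to `1 5` at either end
    -- counts the coefficients of `1 1 5` twice, and the splitting 2 = 1 + 1 at `2 5` counts them
    -- once with a minus sign, whence the weight 2. On the cycle its value is `n`.
    have hs : ∑ a : ZMod n, (coord 5 1 0 1 a (boundary K (ZMod n) 2 (y : Reg K (ZMod n) 3)) +
        2 * coord 5 0 1 1 a (boundary K (ZMod n) 2 (y : Reg K (ZMod n) 3))) = 0 := by
      simp only [coord_boundary hz hn y.2 (p := 1) (q := 0) (r := 1) rfl,
        coord_boundary hz hn y.2 (p := 0) (q := 1) (r := 1) rfl,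
        fun b => coord_eq_zero hz hn y.2 b (p := 1) (q := 0) (r := 1 + 1)
          (fun h => by simp [IsAdmissible] at h) rfl,
        fun b => coord_eq_zero hz hn y.2 b (p := 0) (q := 1 + 1) (r := 1)
          (fun h => by simp [IsAdmissible] at h) rfl,
        fun b => coord_eq_zero hz hn y.2 b (p := 0) (q := 1) (r := 1 + 1)
          (fun h => by simp [IsAdmissible] at h) rfl,
        Finset.sum_add_distrib, ← Finset.mul_sum, zero_add, Nat.reduceAdd]
      rw [sum_sub_right (fun a => coord 5 2 0 1 a (y : Reg K _ 3)) (1 : ZMod n),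
        sum_sub_right (fun a => coord 5 1 1 1 a (y : Reg K _ 3)) (1 : ZMod n),
        sum_sub_right (fun a => coord 5 1 1 1 a (y : Reg K _ 3)) (2 : ZMod n)]
      simp
      ring
    rw [hy'] at hs
    simp [coord_generator hz hn, NeZero.ne n] at hs

end Ranks

/-! ### Betti numbers -/

section Betti

variable {K : Type*} [Field K] [CharZero K] {n : ℕ} [NeZero n]

theorem homology124 (hn : 10 < n) (m : ℕ) :
    Module.Finite K (Homology K (stepGraph n 4) m) ∧
      Module.finrank K (Homology K (stepGraph n 4) m) =
        if m = 0 then 1 else if m = 1 then 1 else 0 := by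
  have hz : (4 : ℕ) = 4 ∨ (4 : ℕ) = 5 := Or.inl rfl
  have hf : ∀ m, Module.Finite K (Omega K (stepGraph n 4) m) := fun m =>
    (finite_finrank_Omega (isEnumeration124 (Or.inl rfl)) hz hn).1
  have ho : ∀ m, Module.finrank K (Omega K (stepGraph n 4) m) = (2 * m + 1) * n := fun m => by
    rw [(finite_finrank_Omega (isEnumeration124 (Or.inl rfl)) hz hn).2, Fintype.card_sum,
      Fintype.card_fin, Fintype.card_fin]
    ring
  have hr0 := rank_zero (K := K) hz hn
  have hr : ∀ m, 1 ≤ m →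
      Module.finrank K (LinearMap.range (dOmega K (stepGraph n 4) m)) = (m + 1) * n := by
    intro m hm
    have h1 := rank_four_ge (K := K) hn hm
    have h2 := rank_four_ge (K := K) (m := m + 1) hn (by omega)
    have h3 := rank_add_rank_le (dOmega K (stepGraph n 4) (m + 1)) (dOmega K (stepGraph n 4) m)
      (dOmega_dOmega _ m)
    rw [ho] at h3
    -- The lower bounds `(m + 1)n` and `(m + 2)n` already fill dimension `(2m + 3)n`.
    nlinarith
  refine ⟨inferInstance, ?_⟩
  rcases m with _ | _ | m
  · have := finrank_homology_zero (K := K) (stepGraph n 4)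
    rw [ho] at this
    change Module.finrank K (Homology K (stepGraph n 4) 0) = 1
    omega
  · have := finrank_homology_succ (K := K) (stepGraph n 4) 0
    rw [ho, hr _ (by omega)] at this
    change Module.finrank K (Homology K (stepGraph n 4) (0 + 1)) = 1
    omega
  · have := finrank_homology_succ (K := K) (stepGraph n 4) (m + 1)
    rw [ho, hr _ (by omega), hr _ (by omega)] at this
    change Module.finrank K (Homology K (stepGraph n 4) (m + 1 + 1)) = 0
    nlinarith

theorem homology125 (hn : 10 < n) (m : ℕ) :
    Module.Finite K (Homology K (stepGraph n 5) m) ∧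
      Module.finrank K (Homology K (stepGraph n 5) m) =
        if m = 0 then 1 else if m = 1 then 2 else if m = 2 then 1 else 0 := by
  have hz : (5 : ℕ) = 4 ∨ (5 : ℕ) = 5 := Or.inr rfl
  obtain ⟨f0, o0⟩ := finite_finrank_Omega (K := K)
    (isEnumeration124 (z := 5) (m := 0) (Or.inr (by norm_num))) hz hn
  obtain ⟨f1, o1⟩ := finite_finrank_Omega (K := K)
    (isEnumeration124 (z := 5) (m := 1) (Or.inr le_rfl)) hz hn
  have f2 : ∀ m, Module.Finite K (Omega K (stepGraph n 5) (m + 2)) := fun m =>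
    (finite_finrank_Omega (isEnumeration125 m) hz hn).1
  have o2 : ∀ m, Module.finrank K (Omega K (stepGraph n 5) (m + 2)) = 4 * n := fun m => by
    rw [(finite_finrank_Omega (isEnumeration125 m) hz hn).2, Fintype.card_fin]
  simp at o0 o1
  have hr0 := rank_zero (K := K) hz hn
  have hr1 := rank_five_one_ge (K := K) hn
  have hr12 := rank_five_one_add_two_lt (K := K) hn
  have hr : ∀ m, Module.finrank K (LinearMap.range (dOmega K (stepGraph n 5) (m + 2))) = 2 * n := by
    intro m
    have h1 := rank_five_ge (K := K) (m := m) hn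
    have h2 : 2 * n ≤ Module.finrank K (LinearMap.range (dOmega K (stepGraph n 5) (m + 3))) :=
      rank_five_ge (m := m + 1) hn
    have h3 := rank_add_rank_le (dOmega K (stepGraph n 5) (m + 3)) (dOmega K (stepGraph n 5) (m + 2))
      (dOmega_dOmega _ (m + 2))
    have h4 := o2 (m + 1)
    rw [h4] at h3
    omega
  rcases m with _ | _ | _ | m
  · have := finrank_homology_zero (K := K) (stepGraph n 5)
    rw [o0] at this
    refine ⟨inferInstance, ?_⟩
    change Module.finrank K (Homology K (stepGraph n 5) 0) = 1
    omega
  · have : Module.finrank K (Homology K (stepGraph n 5) 1) +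
        Module.finrank K (LinearMap.range (dOmega K (stepGraph n 5) 1)) +
        Module.finrank K (LinearMap.range (dOmega K (stepGraph n 5) 0)) =
          Module.finrank K (Omega K (stepGraph n 5) 1) :=
      finrank_homology_succ (K := K) (stepGraph n 5) 0
    have h2 : Module.finrank K (LinearMap.range (dOmega K (stepGraph n 5) 2)) = 2 * n := hr 0
    rw [o1] at this
    refine ⟨inferInstance, ?_⟩
    change Module.finrank K (Homology K (stepGraph n 5) 1) = 2
    omega
  · have f := f2 0
    have : Module.finrank K (Homology K (stepGraph n 5) 2) +
        Module.finrank K (LinearMap.range (dOmega K (stepGraph n 5) 2)) +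
        Module.finrank K (LinearMap.range (dOmega K (stepGraph n 5) 1)) =
          Module.finrank K (Omega K (stepGraph n 5) 2) :=
      finrank_homology_succ (K := K) (stepGraph n 5) 1
    have h2 : Module.finrank K (LinearMap.range (dOmega K (stepGraph n 5) 2)) = 2 * n := hr 0
    have h3 : Module.finrank K (Omega K (stepGraph n 5) 2) = 4 * n := o2 0
    rw [h3] at this
    refine ⟨inferInstance, ?_⟩
    change Module.finrank K (Homology K (stepGraph n 5) 2) = 1
    omega
  · have f := f2 (m + 1)
    have := finrank_homology_succ (K := K) (stepGraph n 5) (m + 2)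
    have h2 := hr m
    have h3 : Module.finrank K (LinearMap.range (dOmega K (stepGraph n 5) (m + 2 + 1))) = 2 * n :=
      hr (m + 1)
    have h4 : Module.finrank K (Omega K (stepGraph n 5) (m + 2 + 1)) = 4 * n := o2 (m + 1)
    rw [h2, h3, h4] at this
    refine ⟨inferInstance, ?_⟩
    change Module.finrank K (Homology K (stepGraph n 5) (m + 2 + 1)) = 0
    omega

end Betti

/-! ### Ranks on the eigenspaces -/

section Eigenspaces

variable {K : Type*} [Field K] [CharZero K] {n z m : ℕ} [NeZero n] {lam : K}

omit [CharZero K] [NeZero n] in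
theorem dEig_dEig (S : Set (ZMod n)) (x : OmegaEig K n S lam (m + 2)) :
    dEig K n S lam m (dEig K n S lam (m + 1) x) = 0 :=
  Subtype.ext (boundary_boundary K (ZMod n) m x)

omit [CharZero K] in
theorem coord_eq_zero_of_eigen {x : Reg K (ZMod n) m}
    (hx : x ∈ OmegaEig K n {1, 2, (z : ZMod n)} lam m) {p q r : ℕ}
    (h : coord z p q r (0 : ZMod n) x = 0) (a : ZMod n) : coord z p q r a x = 0 := by
  have e := coord_sub (z := z) hx.2 p q r 0 (-a).val
  rwa [ZMod.natCast_val, ZMod.cast_id, zero_sub, neg_neg, h, mul_zero] at e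

/-- The coefficient of the path with start `0` and steps `1^p 2^q z^r`, on `Ω_m^{(lam)}`. -/
noncomputable def coordEig (n z m : ℕ) (lam : K) (p q r : ℕ) :
    OmegaEig K n {1, 2, (z : ZMod n)} lam m →ₗ[K] K :=
  coord z p q r 0 ∘ₗ (OmegaEig K n {1, 2, (z : ZMod n)} lam m).subtype

theorem rank_eig_four_ge (hn : 10 < n) (hlam : lam ^ n = 1) (hm : 1 ≤ m) :
    m + 1 ≤ Module.finrank K (LinearMap.range (dEig K n {1, 2, ((4 : ℕ) : ZMod n)} lam m)) := by
  have b := eigBasis (isEnumeration124 (z := 4) (m := m + 1) (Or.inl rfl)) (Or.inl rfl) hn hlam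
  have hf := Module.Finite.of_basis b
  have := finrank_le_rank_add (dEig K n {1, 2, ((4 : ℕ) : ZMod n)} lam m)
    (LinearMap.pi fun k : Fin (m + 2) => coordEig n 4 (m + 1) lam (freeIndex m k).1
      (freeIndex m k).2.1 (freeIndex m k).2.2) fun x hd hc =>
    Subtype.ext (eq_zero_of_freeIndex hn hm x.2.1 (congrArg Subtype.val hd) fun k hk a =>
      coord_eq_zero_of_eigen x.2 (congrFun hc ⟨k, hk⟩) a)
  rw [Module.finrank_eq_card_basis b] at this
  simp [-Nat.cast_ofNat] at this
  omega

/-- The constancy argument in degree 1 now reads `lam * c = c`, so `c = 0` unless `lam = 1`. -/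
theorem rank_eig_four_zero_ge (hn : 10 < n) (hlam : lam ^ n = 1) (h1 : lam ≠ 1) :
    1 ≤ Module.finrank K (LinearMap.range (dEig K n {1, 2, ((4 : ℕ) : ZMod n)} lam 0)) := by
  have b := eigBasis (isEnumeration124 (z := 4) (m := 1) (Or.inl rfl)) (Or.inl rfl) hn hlam
  have hf := Module.Finite.of_basis b
  have hd3 : Module.finrank K (OmegaEig K n {1, 2, ((4 : ℕ) : ZMod n)} lam (0 + 1)) = 3 :=
    Module.finrank_eq_card_basis b
  have := finrank_le_rank_add (dEig K n {1, 2, ((4 : ℕ) : ZMod n)} lam 0)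
    ((coordEig n 4 1 lam 0 1 0).prod (coordEig n 4 1 lam 0 0 1)) fun x hd hc => by
      rw [← LinearMap.mem_ker, LinearMap.ker_prod] at hc
      have hd0 : boundary K (ZMod n) 0 (x : Reg K (ZMod n) 1) = 0 := congrArg Subtype.val hd
      have h2 := coord_eq_zero_of_eigen x.2 (LinearMap.mem_ker.1 hc.1)
      have h3 := coord_eq_zero_of_eigen x.2 (LinearMap.mem_ker.1 hc.2)
      refine Subtype.ext (eq_zero_of_boundary_degree_one (Or.inl rfl) hn x.2.1 hd0 h2 h3 ?_)
      have hE := coord_boundary (Or.inl rfl) hn x.2.1 (p := 0) (q := 0) (r := 0) rfl 0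
      simp only [hd0, map_zero, zero_add, h2, h3, coord_sub_one x.2.2] at hE
      simp at hE
      have h0 : (lam - 1) * coord 4 1 0 0 (0 : ZMod n) (x : Reg K (ZMod n) 1) = 0 := by
        linear_combination -hE
      exact (mul_eq_zero.1 h0).resolve_left (sub_ne_zero.2 h1)
  rw [hd3, Module.finrank_prod, Module.finrank_self] at this
  omega

theorem rank_eig_five_ge (hn : 10 < n) (hlam : lam ^ n = 1) :
    2 ≤ Module.finrank K
      (LinearMap.range (dEig K n {1, 2, ((5 : ℕ) : ZMod n)} lam (m + 2))) := by
  have b := eigBasis (isEnumeration125 (m + 1)) (Or.inr rfl) hn hlam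
  have hf := Module.Finite.of_basis b
  have hd4 : Module.finrank K (OmegaEig K n {1, 2, ((5 : ℕ) : ZMod n)} lam (m + 2 + 1)) = 4 := by
    rw [← Fintype.card_fin 4]
    exact Module.finrank_eq_card_basis b
  have := finrank_le_rank_add (dEig K n {1, 2, ((5 : ℕ) : ZMod n)} lam (m + 2))
    ((coordEig n 5 (m + 3) lam (m + 2) 1 0).prod (coordEig n 5 (m + 3) lam (m + 1) 1 1))
    fun x hd hc => by
      rw [← LinearMap.mem_ker, LinearMap.ker_prod] at hc
      exact Subtype.ext (eq_zero_of_boundary_five hn x.2.1 (congrArg Subtype.val hd)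
        (coord_eq_zero_of_eigen x.2 (LinearMap.mem_ker.1 hc.1))
        (coord_eq_zero_of_eigen x.2 (LinearMap.mem_ker.1 hc.2)))
  rw [hd4, Module.finrank_prod, Module.finrank_self] at this
  omega

theorem rank_toMatrix {K A B ι κ : Type*} [Field K] [AddCommGroup A] [AddCommGroup B] [Module K A]
    [Module K B] [Fintype ι] [Fintype κ] [DecidableEq κ] (b : Module.Basis κ K A)
    (c : Module.Basis ι K B) (f : A →ₗ[K] B) :
    (LinearMap.toMatrix b c f).rank = Module.finrank K (LinearMap.range f) := by
  classical
  rw [Matrix.rank_eq_finrank_range_toLin _ c b, Matrix.toLin_toMatrix]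

end Eigenspaces
end PathComplex

/-! ### Assembly of both cases -/

open PathComplex in
theorem mainTheorem8 :
    (∃ M : (m : ℕ) → Matrix (Fin (m + 1) ⊕ Fin m) (Fin (m + 1 + 1) ⊕ Fin (m + 1)) ℤ[X],
      ∀ (K : Type*) [Field K] [CharZero K] (n : ℕ), 10 < n →
        (∀ m : ℕ,
          Module.Finite K (PathComplex.Homology K (PathComplex.circulant n {1, 2, 4}) m) ∧
          Module.finrank K (PathComplex.Homology K (PathComplex.circulant n {1, 2, 4}) m) =
            if m = 0 then 1 else if m = 1 then 1 else 0) ∧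
        ∀ lam : K, lam ^ n = 1 →
          ∃ b : (m : ℕ) → Module.Basis (Fin (m + 1) ⊕ Fin m) K
              (PathComplex.OmegaEig K n {1, 2, 4} lam m),
            (∀ m i, (b m i : PathComplex.Reg K (ZMod n) m) =
              PathComplex.alternator K n lam m (PathComplex.letters124 m i)) ∧
            (∀ m, Module.finrank K (PathComplex.OmegaEig K n {1, 2, 4} lam m) = 2 * m + 1) ∧
            (∀ m, LinearMap.toMatrix (b (m + 1)) (b m)
              (PathComplex.dEig K n {1, 2, 4} lam m) = (M m).map (aeval lam)) ∧
            (∀ m, 1 ≤ m ∨ lam ≠ 1 → ((M m).map (aeval lam)).rank = m + 1)) ∧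
    (∃ M : ℕ → Matrix (Fin 4) (Fin 4) ℤ[X],
      ∀ (K : Type*) [Field K] [CharZero K] (n : ℕ), 10 < n →
        (∀ m : ℕ,
          Module.Finite K (PathComplex.Homology K (PathComplex.circulant n {1, 2, 5}) m) ∧
          Module.finrank K (PathComplex.Homology K (PathComplex.circulant n {1, 2, 5}) m) =
            if m = 0 then 1 else if m = 1 then 2 else if m = 2 then 1 else 0) ∧
        ∀ lam : K, lam ^ n = 1 →
          ∃ b : (m : ℕ) → Module.Basis (Fin 4) K
              (PathComplex.OmegaEig K n {1, 2, 5} lam (m + 2)),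
            (∀ m i, (b m i : PathComplex.Reg K (ZMod n) (m + 2)) =
              PathComplex.alternator K n lam (m + 2) (PathComplex.letters125 (m + 2) i)) ∧
            (∀ m, Module.finrank K (PathComplex.OmegaEig K n {1, 2, 5} lam (m + 2)) = 4) ∧
            (∀ m, LinearMap.toMatrix (b (m + 1)) (b m)
              (PathComplex.dEig K n {1, 2, 5} lam (m + 2)) = (M m).map (aeval lam)) ∧
            (∀ m, ((M m).map (aeval lam)).rank = 2)) := by
  constructor
  -- The matrix is fixed before `K`, `n` and `lam` are introduced. `M m` represents `∂_{m+1}`.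
  · refine ⟨fun m => Matrix.of fun i j => symbol 4 (multiplicities124 m i).1
      (multiplicities124 m i).2.1 (multiplicities124 m i).2.2 (multiplicities124 (m + 1) j), ?_⟩
    intro K _ _ n hn
    have : NeZero n := ⟨by omega⟩
    have hS : ({1, 2, 4} : Set (ZMod n)) = {1, 2, ((4 : ℕ) : ZMod n)} := by simp
    rw [hS]
    refine ⟨homology124 hn, fun lam hlam => ?_⟩
    have he : ∀ m, IsEnumeration 4 m (multiplicities124 m) := fun m => isEnumeration124 (Or.inl rfl)
    have hz : (4 : ℕ) = 4 ∨ (4 : ℕ) = 5 := Or.inl rfl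
    have hd : ∀ m, Module.finrank K (OmegaEig K n {1, 2, ((4 : ℕ) : ZMod n)} lam m) = 2 * m + 1 :=
      fun m => by
        rw [Module.finrank_eq_card_basis (eigBasis (he m) hz hn hlam)]
        simp
        ring
    refine ⟨fun m => eigBasis (he m) hz hn hlam, fun m i => ?_, hd,
      fun m => toMatrix_dEig (he m) (he (m + 1)) hz hn hlam, fun m hm => ?_⟩
    · rw [eigBasis_apply, sortedWord_multiplicities124]
    · rw [← toMatrix_dEig (he m) (he (m + 1)) hz hn hlam, rank_toMatrix]
      have hf : ∀ m, Module.Finite K (OmegaEig K n {1, 2, ((4 : ℕ) : ZMod n)} lam m) := fun m =>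
        Module.Finite.of_basis (eigBasis (he m) hz hn hlam)
      rcases m with _ | m
      · have h1 := rank_eig_four_zero_ge hn hlam (by simpa using hm)
        have h2 := (LinearMap.range (dEig K n {1, 2, ((4 : ℕ) : ZMod n)} lam 0)).finrank_le
        rw [hd] at h2
        omega
      -- The bounds `m + 2` and `m + 3` fill the dimension `2m + 5`, which forces equality.
      · have h1 := rank_eig_four_ge hn hlam (m := m + 1) (by omega)
        have h2 := rank_eig_four_ge hn hlam (m := m + 2) (by omega)
        have h3 := rank_add_rank_le (dEig K n {1, 2, ((4 : ℕ) : ZMod n)} lam (m + 2))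
          (dEig K n {1, 2, ((4 : ℕ) : ZMod n)} lam (m + 1)) (dEig_dEig _)
        rw [hd] at h3
        omega
  -- Here `M m` represents `∂_{m+3}`, as the four-element bases start in degree 2.
  · refine ⟨fun m => Matrix.of fun i j => symbol 5 (multiplicities125 m i).1
      (multiplicities125 m i).2.1 (multiplicities125 m i).2.2 (multiplicities125 (m + 1) j), ?_⟩
    intro K _ _ n hn
    have : NeZero n := ⟨by omega⟩
    have hS : ({1, 2, 5} : Set (ZMod n)) = {1, 2, ((5 : ℕ) : ZMod n)} := by simp
    rw [hS]
    refine ⟨homology125 hn, fun lam hlam => ?_⟩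
    have hz : (5 : ℕ) = 4 ∨ (5 : ℕ) = 5 := Or.inr rfl
    have hd : ∀ m, Module.finrank K (OmegaEig K n {1, 2, ((5 : ℕ) : ZMod n)} lam (m + 2)) = 4 :=
      fun m => by
        rw [Module.finrank_eq_card_basis (eigBasis (isEnumeration125 m) hz hn hlam),
          Fintype.card_fin]
    refine ⟨fun m => eigBasis (isEnumeration125 m) hz hn hlam, fun m i => ?_, hd,
      fun m => toMatrix_dEig (isEnumeration125 m) (isEnumeration125 (m + 1)) hz hn hlam,
      fun m => ?_⟩
    · rw [eigBasis_apply, sortedWord_multiplicities125]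
    · rw [← toMatrix_dEig (isEnumeration125 m) (isEnumeration125 (m + 1)) hz hn hlam, rank_toMatrix]
      have hf : Module.Finite K (OmegaEig K n {1, 2, ((5 : ℕ) : ZMod n)} lam (m + 2 + 1)) :=
        Module.Finite.of_basis (eigBasis (isEnumeration125 (m + 1)) hz hn hlam)
      have h1 := rank_eig_five_ge (m := m) hn hlam
      have h2 : 2 ≤ Module.finrank K
          (LinearMap.range (dEig K n {1, 2, ((5 : ℕ) : ZMod n)} lam (m + 2 + 1))) :=
        rank_eig_five_ge (m := m + 1) hn hlam
      have h3 := rank_add_rank_le (dEig K n {1, 2, ((5 : ℕ) : ZMod n)} lam (m + 2 + 1))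
        (dEig K n {1, 2, ((5 : ℕ) : ZMod n)} lam (m + 2)) (dEig_dEig _)
      have h4 : Module.finrank K (OmegaEig K n {1, 2, ((5 : ℕ) : ZMod n)} lam (m + 2 + 1)) = 4 :=
        hd (m + 1)
      rw [h4] at h3
      omega
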